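/- Let $\mathfrak g$ be a finite-dimensional complex simple Lie algebra with Cartan subalgebra $\mathfrak h$, simple roots $\alpha_i$ ($i\in I$), positive roots $R^+$ and highest root $\theta$. For $\alpha\in R^+$ let $h_\alpha\in\mathfrak h$ be the coroot, and fix root vectors $x_\alpha^\pm\in\mathfrak g_{\pm\alpha}$ with $[x_\alpha^+,x_\alpha^-]=h_\alpha$, $[h_\alpha,x^\pm_\alpha]=\pm2x^\pm_\alpha$; write $h_i=h_{\alpha_i}$, $x_i^\pm=x_{\alpha_i}^\pm$. Let $L(\mathfrak g)=\mathfrak g\otimes\mathbb C[t,t^{-1}]$, write $x_m=x\otimes t^m$, and let $L^e(\mathfrak g)=L(\mathfrak g)\oplus\mathbb C d$ with $[d,x_m]=m\,x_m$. Put $\mathfrak h^e=\mathfrak h\oplus\mathbb Cd$, $\mathbf U=U(L(\mathfrak g))$, $\mathbf U^e=U(L^e(\mathfrak g))$, and let $\mathbf U(0)\subset\mathbf U$ be the (commutative) subalgebra generated by the $h_{\alpha,m}$ with $\alpha$ a root and $m\ne0$. A $\mathbf U^e$-module $V$ is called integrable if $x^\pm_i\otimes1$ ($i\in I$) and $e_0^{\pm}=x_\theta^\mp\otimes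 t^{\pm1}$ act locally nilpotently on $V$ and $V=\bigoplus_{\mu\in(\mathfrak h^e)^*}V_\mu$, where $V_\mu=\{v: hv=\mu(h)v\ \ \forall h\in\mathfrak h^e\}$. Let $P^e_+$ be the set of $\lambda\in(\mathfrak h^e)^*$ with $\lambda(h_i)\in\mathbb Z_{\ge0}$ for all $i\in I$ and $\lambda(d)\in\mathbb Z$. For $i\in I$ define $\Lambda_{i,m}\in\mathbf U(0)$, $m\in\mathbb Z$, by $\Lambda_i^\pm(u)=\sum_{m\ge0}\Lambda_{i,\pm m}u^m=\exp\bigl(-\sum_{k\ge1}\tfrac{h_{i,\pm k}}{k}u^k\bigr)$, and put $X^-_{i,0}(u)=\sum_{m\ge0}x^-_{i,m}u^{m+1}$. For $\lambda\in(\mathfrak h^e)^*$ with all $\lambda(h_i)\in\mathbb Z_{\ge0}$ let $\tilde I_\lambda$ be the left ideal of $\mathbf U$ generated by - $x^+_{i,m}$ ($i\in I$, $m\in\mathbb Z$), and $h-\lambda(h)$ ($h\in\mathfrak h$); - $\Lambda_{i,m}$ ($i\in I$, $|m|>\lambda(h_i)$), and $\Lambda_{i,\lambda(h_i)}\Lambda_{i,-m}-\Lambda_{i,\lambda(h_i)-m}$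 ($i\in I$, $1\le m\le\lambda(h_i)$); - $\bigl(\sum_{j=0}^{\lambda(h_i)}x^-_{i,m-j-1}\Lambda_{i,j}\bigr)a$ ($i\in I$, $m\in\mathbb Z$, $a\in\mathbf U(0)$); - $\bigl(X^-_{i,0}(u)^r\Lambda_i^+(u)\bigr)_m\,a$ ($i\in I$, $r\ge1$, $m>\lambda(h_i)$, $a\in\mathbf U(0)$), where $(\cdot)_m$ is the coefficient of $u^m$. Let $\tilde I^e_\lambda$ be the left ideal of $\mathbf U^e$ generated by $\tilde I_\lambda$ and $d-\lambda(d)$, and $W(\lambda)=\mathbf U^e/\tilde I^e_\lambda$. As a left $\mathbf U$-module $W(\lambda)$ is $\mathbf U/\tilde I_\lambda$, and since $\tilde I_\lambda\mathbf U(0)\subset\tilde I_\lambda$ the latter is also a right $\mathbf U(0)$-module. For a tuple $\boldsymbol\pi=(\pi_i)_{i\in I}$ of complex polynomials in $u$ with constant term $1$ put $\pi_i^+=\pi_i$, let $\pi_i^-(u)$ be $u^{\deg\pi_i}\pi_i(u^{-1})$ divided by its constant term, and let $\mathbb C_{\boldsymbol\pi}$ be the quotient of $\mathbf U(0)$ by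 the ideal generated by all coefficients of $\Lambda_i^\pm(u)-\pi_i^\pm(u)$, $i\in I$. For $a\in\mathbb C$ let $\lambda_{\boldsymbol\pi,a}\in(\mathfrak h^e)^*$ be given by $\lambda_{\boldsymbol\pi,a}(h_i)=\deg\pi_i$, $\lambda_{\boldsymbol\pi,a}(d)=a$, and let $W(\boldsymbol\pi)=W(\lambda_{\boldsymbol\pi,a})\otimes_{\mathbf U(0)}\mathbb C_{\boldsymbol\pi}$, a left $\mathbf U$-module, where $W(\lambda_{\boldsymbol\pi,a})=\mathbf U/\tilde I_{\lambda_{\boldsymbol\pi,a}}$. **Theorem.** (i) For every $\lambda\in P^e_+$, $W(\lambda)$ is an integrable $\mathbf U^e$-module. (ii) For every tuple $\boldsymbol\pi$ of polynomials with constant term $1$ (and every $a\in\mathbb C$), $W(\boldsymbol\pi)$ is finite-dimensional. -/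

import Mathlib

open scoped TensorProduct

noncomputable section

namespace WeylModule

open LieAlgebra LieAlgebra.IsKilling Module

attribute [local instance 100] LieRing.ofAssociativeRing

/-- The linear map `t d/dt` on `ℂ[t, t⁻¹]`, given by `t ^ m ↦ m t ^ m`. -/
def eulerMap : AddMonoidAlgebra ℂ ℤ →ₗ[ℂ] AddMonoidAlgebra ℂ ℤ :=
  (AddMonoidAlgebra.basis ℤ ℂ).constr ℂ fun m => AddMonoidAlgebra.single m (m : ℂ)

theorem eulerMap_single (m : ℤ) (c : ℂ) :
    eulerMap (AddMonoidAlgebra.single m c) = AddMonoidAlgebra.single m (c * m) := by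
  have h : (AddMonoidAlgebra.single m c : AddMonoidAlgebra ℂ ℤ) =
      c • AddMonoidAlgebra.basis ℤ ℂ m := by
    rw [AddMonoidAlgebra.basis_apply, AddMonoidAlgebra.smul_single, smul_eq_mul, mul_one]
  rw [h, map_smul, eulerMap, Basis.constr_basis, AddMonoidAlgebra.smul_single, smul_eq_mul]

/-- The derivation `t d/dt` of the Laurent polynomial ring `ℂ[t, t⁻¹]`. -/
def eulerDerivation :
    Derivation ℂ (AddMonoidAlgebra ℂ ℤ) (AddMonoidAlgebra ℂ ℤ) :=
  Derivation.mk' eulerMap <| by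
    intro a b
    induction a using AddMonoidAlgebra.induction_linear with
    | zero => simp
    | add a a' h h' => simp only [add_mul, map_add, h, h', smul_eq_mul, mul_add]; ring
    | single m c =>
      induction b using AddMonoidAlgebra.induction_linear with
      | zero => simp
      | add a a' h h' => simp only [mul_add, map_add, h, h', smul_eq_mul, add_mul]; ring
      | single n e =>
        simp only [AddMonoidAlgebra.single_mul_single, eulerMap_single, smul_eq_mul]
        rw [add_comm n m, ← AddMonoidAlgebra.single_add]
        congr 1
        push_cast
        ring

/-- The loop algebra `L(𝔤) = 𝔤 ⊗ ℂ[t, t⁻¹]`. -/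
abbrev Loop (g : Type*) [LieRing g] [LieAlgebra ℂ g] := loopAlgebra ℂ ℤ g

/-- The action of the one-dimensional Lie algebra `ℂ d` on the loop algebra: `d` acts as
`t d/dt`. -/
def degreeAction (g : Type*) [LieRing g] [LieAlgebra ℂ g] :
    ℂ →ₗ⁅ℂ⁆ LieDerivation ℂ (Loop g) (Loop g) where
  toLinearMap := LinearMap.toSpanSingleton ℂ _ (Lie.Derivation.ofDerivation g eulerDerivation)
  map_lie' := by
    intro x y
    simp [LieRing.of_associative_ring_bracket, mul_comm]

/-- The extended loop algebra `Lᵉ(𝔤) = L(𝔤) ⊕ ℂ d`. -/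
def ExtLoop (g : Type*) [LieRing g] [LieAlgebra ℂ g] :=
  SemiDirectSum (Loop g) ℂ (degreeAction g)

instance (g : Type*) [LieRing g] [LieAlgebra ℂ g] : LieRing (ExtLoop g) :=
  inferInstanceAs (LieRing (SemiDirectSum (Loop g) ℂ (degreeAction g)))

instance (g : Type*) [LieRing g] [LieAlgebra ℂ g] : LieAlgebra ℂ (ExtLoop g) :=
  inferInstanceAs (LieAlgebra ℂ (SemiDirectSum (Loop g) ℂ (degreeAction g)))

/-- The inclusion `L(𝔤) ⊆ Lᵉ(𝔤)`. -/
def loopIncl (g : Type*) [LieRing g] [LieAlgebra ℂ g] : Loop g →ₗ⁅ℂ⁆ ExtLoop g :=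
  SemiDirectSum.inl (degreeAction g)

/-- The element `d` of `Lᵉ(𝔤)`. -/
def extD (g : Type*) [LieRing g] [LieAlgebra ℂ g] : ExtLoop g :=
  SemiDirectSum.inr (degreeAction g) 1

/-- `ULoop g` is `U(L(𝔤))`. -/
abbrev ULoop (g : Type*) [LieRing g] [LieAlgebra ℂ g] := UniversalEnvelopingAlgebra ℂ (Loop g)

/-- `UExt g` is `U(Lᵉ(𝔤))`. -/
abbrev UExt (g : Type*) [LieRing g] [LieAlgebra ℂ g] := UniversalEnvelopingAlgebra ℂ (ExtLoop g)

/-- The canonical homomorphism `U(L(𝔤)) → U(Lᵉ(𝔤))` induced by the inclusion. -/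
def uIncl (g : Type*) [LieRing g] [LieAlgebra ℂ g] : ULoop g →ₐ[ℂ] UExt g :=
  UniversalEnvelopingAlgebra.lift ℂ ((UniversalEnvelopingAlgebra.ι ℂ).comp (loopIncl g))

variable {g : Type*} [LieRing g] [LieAlgebra ℂ g]

/-- `x_m = x ⊗ t ^ m`, as an element of `L(𝔤)`. -/
def loopElt (x : g) (m : ℤ) : Loop g := AddMonoidAlgebra.single m (1 : ℂ) ⊗ₜ[ℂ] x

theorem lie_loopElt (x y : g) (m n : ℤ) :
    ⁅loopElt x m, loopElt y n⁆ = loopElt ⁅x, y⁆ (m + n) := by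
  rw [loopElt, loopElt, LieAlgebra.ExtendScalars.bracket_tmul,
    AddMonoidAlgebra.single_mul_single, one_mul, loopElt]

theorem degreeAction_loopElt (c : ℂ) (x : g) (m : ℤ) :
    degreeAction g c (loopElt x m) = (c * m) • loopElt x m := by
  have h : Lie.Derivation.ofDerivation g eulerDerivation (loopElt x m) =
      (m : ℂ) • loopElt x m := by
    change (eulerMap (AddMonoidAlgebra.single m 1)) ⊗ₜ[ℂ] x = _
    rw [eulerMap_single, loopElt, TensorProduct.smul_tmul', AddMonoidAlgebra.smul_single,
      smul_eq_mul, mul_comm]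
  change (c • Lie.Derivation.ofDerivation g eulerDerivation) (loopElt x m) = _
  rw [LieDerivation.smul_apply, h, smul_smul]

theorem lie_extD (x : g) (m : ℤ) :
    ⁅extD g, loopIncl g (loopElt x m)⁆ = (m : ℂ) • loopIncl g (loopElt x m) := by
  apply SemiDirectSum.ext
  · change ⁅(0 : Loop g), loopElt x m⁆ + degreeAction g 1 (loopElt x m) - degreeAction g 0 0 =
      (m : ℂ) • loopElt x m
    have h : ⁅(0 : Loop g), loopElt x m⁆ = 0 := zero_lie (loopElt x m)
    rw [degreeAction_loopElt, map_zero, sub_zero, h, zero_add, one_mul]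
  · change ⁅(1 : ℂ), (0 : ℂ)⁆ = (m : ℂ) • (0 : ℂ)
    rw [lie_zero, smul_zero]

/-- `x_m = x ⊗ t ^ m`, as an element of `U(L(𝔤))`. -/
def uElt (x : g) (m : ℤ) : ULoop g := UniversalEnvelopingAlgebra.ι ℂ (loopElt x m)

/-- `x_m = x ⊗ t ^ m`, as an element of `U(Lᵉ(𝔤))`. -/
def uExtElt (x : g) (m : ℤ) : UExt g := UniversalEnvelopingAlgebra.ι ℂ (loopIncl g (loopElt x m))

theorem uElt_mul (x y : g) (m n : ℤ) :
    uElt x m * uElt y n = uElt y n * uElt x m + uElt ⁅x, y⁆ (m + n) := by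
  have h : UniversalEnvelopingAlgebra.ι ℂ ⁅loopElt x m, loopElt y n⁆ =
      uElt x m * uElt y n - uElt y n * uElt x m :=
    LieHom.map_lie (UniversalEnvelopingAlgebra.ι ℂ) (loopElt x m) (loopElt y n)
  have h2 : UniversalEnvelopingAlgebra.ι ℂ ⁅loopElt x m, loopElt y n⁆ = uElt ⁅x, y⁆ (m + n) :=
    congrArg _ (lie_loopElt x y m n)
  rw [← h2, h]
  abel

section Exp

variable {A : Type*} [Ring A] [Algebra ℂ A]

/-- The exponential `∑ₙ Fⁿ / n!` of a formal power series `F` with zero constant term, over a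
possibly noncommutative `ℂ`-algebra. As `Fⁿ` is divisible by `uⁿ`, only the terms with `n ≤ m`
contribute to the coefficient of `u ^ m`. -/
def expSeries (F : PowerSeries A) : PowerSeries A :=
  PowerSeries.mk fun m => ∑ n ∈ Finset.range (m + 1),
    ((n.factorial : ℂ)⁻¹) • PowerSeries.coeff m (F ^ n)

end Exp

/-- For `ε = ±1` and `h` in the Cartan subalgebra, the power series
`exp (- ∑_{k ≥ 1} h_{εk} / k u ^ k)` with coefficients in `U(L(𝔤))`. -/
def lambdaSeries (h : g) (ε : ℤ) : PowerSeries (ULoop g) :=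
  expSeries (PowerSeries.mk fun k =>
    if k = 0 then 0 else -((k : ℂ)⁻¹ • uElt h (ε * k)))

/-- `Λ_m`, for `m ∈ ℤ`: the coefficient of `u ^ |m|` in `Λ⁺` if `m ≥ 0`, in `Λ⁻` if `m ≤ 0`. -/
def lambdaElt (h : g) (m : ℤ) : ULoop g :=
  PowerSeries.coeff m.natAbs (lambdaSeries h (if 0 ≤ m then 1 else -1))

/-- The power series `X⁻_{·,0}(u) = ∑_{m ≥ 0} x_m u ^ (m + 1)` with coefficients in `U(L(𝔤))`. -/
def xZeroSeries (x : g) : PowerSeries (ULoop g) :=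
  PowerSeries.mk fun m => if m = 0 then 0 else uElt x ((m : ℤ) - 1)

variable [FiniteDimensional ℂ g] [IsKilling ℂ g]
variable {H : LieSubalgebra ℂ g} [H.IsCartanSubalgebra]

/-- A choice of root vectors `x_α^±` for the positive roots `α`:
`x_α^± ∈ 𝔤_{±α}`, `[x_α^+, x_α^-] = h_α`, `[h_α, x_α^±] = ± 2 x_α^±`, where `h_α` is the coroot. -/
structure RootVectors (b : (rootSystem H).Base) where
  /-- `x_α^+`; only its values at positive roots matter. -/
  pos : H.root → g
  /-- `x_α^-`; only its values at positive roots matter. -/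
  neg : H.root → g
  pos_mem : ∀ α, b.IsPos α → pos α ∈ rootSpace H (α : LieModule.Weight ℂ H g)
  neg_mem : ∀ α, b.IsPos α → neg α ∈ rootSpace H (-(α : LieModule.Weight ℂ H g))
  sl2 : ∀ α, b.IsPos α → IsSl2Triple ((rootSystem H).coroot α : g) (pos α) (neg α)

/-- `θ` is the highest root: `θ - β` is a sum of simple roots for every root `β`. -/
def IsHighestRoot (b : (rootSystem H).Base) (θ : H.root) : Prop :=
  ∀ β : H.root, (rootSystem H).root θ - (rootSystem H).root β ∈
    AddSubmonoid.closure ((rootSystem H).root '' b.support)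

section Integrable

/-- The inclusion into `Lᵉ(𝔤)` of its Cartan subalgebra `𝔥ᵉ = 𝔥 ⊕ ℂ d`. -/
def cartanIncl (H : LieSubalgebra ℂ g) : H × ℂ →ₗ[ℂ] ExtLoop g :=
  LinearMap.coprod
    ((loopIncl g : Loop g →ₗ[ℂ] ExtLoop g) ∘ₗ
      (TensorProduct.mk ℂ (AddMonoidAlgebra ℂ ℤ) g (AddMonoidAlgebra.single 0 1)) ∘ₗ
      H.toSubmodule.subtype)
    (LinearMap.toSpanSingleton ℂ _ (extD g))

variable (V : Type*) [AddCommGroup V] [Module ℂ V] [Module (UExt g) V] [IsScalarTower ℂ (UExt g) V]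

/-- The weight space `V_μ` of a `U(Lᵉ(𝔤))`-module, for `μ ∈ (𝔥ᵉ)*`. -/
def weightSpace (H : LieSubalgebra ℂ g) (μ : Dual ℂ (H × ℂ)) : Submodule ℂ V where
  carrier := {v | ∀ h : H × ℂ, UniversalEnvelopingAlgebra.ι ℂ (cartanIncl H h) • v = μ h • v}
  add_mem' := fun hv hw h => by simp only [smul_add, hv h, hw h]
  zero_mem' := fun h => by simp
  smul_mem' := fun c v hv h => by
    rw [smul_algebra_smul_comm, hv h, smul_comm]

/-- `a` acts locally nilpotently on `V`. -/
def IsLocallyNilpotent (a : UExt g) : Prop := ∀ v : V, ∃ N : ℕ, a ^ N • v = 0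

open Classical in
/-- Integrable `U(Lᵉ(𝔤))`-modules: the Chevalley generators `e_i^± = x_i^± ⊗ 1` (`i ∈ I`) and
`e_0^± = x_θ^∓ ⊗ t ^ (±1)` act locally nilpotently and the module is the direct sum of its
weight spaces. -/
structure IsIntegrable {b : (rootSystem H).Base} (X : RootVectors b) (θ : H.root) : Prop where
  pos : ∀ i : b.support, IsLocallyNilpotent V (uExtElt (X.pos i) 0)
  neg : ∀ i : b.support, IsLocallyNilpotent V (uExtElt (X.neg i) 0)
  zero_pos : IsLocallyNilpotent V (uExtElt (X.neg θ) 1)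
  zero_neg : IsLocallyNilpotent V (uExtElt (X.pos θ) (-1))
  isInternal : DirectSum.IsInternal (weightSpace V H)

end Integrable

/-- `λ ∈ P₊ᵉ = ⨁ ℕ ω_i ⊕ ℤ δ`: all `λ(h_i)` are non-negative integers and `λ(d) ∈ ℤ`. -/
def IsDominantIntegral (b : (rootSystem H).Base) (lam : Dual ℂ (H × ℂ)) : Prop :=
  (∀ i : b.support, ∃ k : ℕ, lam ((rootSystem H).coroot i, 0) = k) ∧ ∃ r : ℤ, lam (0, 1) = r

/-- The subalgebra `U(0)` of `U(L(𝔤))` generated by the `h_{α, m}` with `α` a root, `m ≠ 0`. -/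
def uZero (H : LieSubalgebra ℂ g) [H.IsCartanSubalgebra] : Subalgebra ℂ (ULoop g) :=
  Algebra.adjoin ℂ {u | ∃ (α : H.root) (m : ℤ), m ≠ 0 ∧
    u = uElt ((rootSystem H).coroot α : g) m}

variable {b : (rootSystem H).Base}

/-- `h_i`, as an element of `𝔤`. -/
def simpleCoroot (b : (rootSystem H).Base) (i : b.support) : g := ((rootSystem H).coroot i : g)

/-- The generators of the left ideal of `U(L(𝔤))` defining `W(λ)`. In each clause `k = λ(h_i)`.
Since `Λ_{i,m}` belongs to the ideal for `m > k` (and `U(0)` is commutative), the coefficient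
of `u ^ m` in `X̃⁻_i(u) Λ⁺_i(u) = (∑_{n ∈ ℤ} x⁻_{i,n} u ^ (n + 1)) (∑_{j ≥ 0} Λ_{i,j} u ^ j)`
stands for its part with `j ≤ k`, the rest being an infinite sum of elements of the ideal. -/
inductive LoopGen (X : RootVectors b) (lam : Dual ℂ (H × ℂ)) : ULoop g → Prop
  | cartan (h : H) : LoopGen X lam (uElt (h : g) 0 - algebraMap ℂ _ (lam (h, 0)))
  | lambda (i : b.support) (k : ℕ) (hk : lam ((rootSystem H).coroot i, 0) = k)
      (m : ℤ) (hm : k < |m|) :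
      LoopGen X lam (lambdaElt (simpleCoroot b i) m)
  | lambda_mul (i : b.support) (k : ℕ) (hk : lam ((rootSystem H).coroot i, 0) = k)
      (m : ℤ) (hm : 1 ≤ m) (hmk : m ≤ k) :
      LoopGen X lam (lambdaElt (simpleCoroot b i) k * lambdaElt (simpleCoroot b i) (-m) -
        lambdaElt (simpleCoroot b i) (k - m))
  | xTilde (i : b.support) (k : ℕ) (hk : lam ((rootSystem H).coroot i, 0) = k)
      (m : ℤ) (a : ULoop g) (ha : a ∈ uZero H) :
      LoopGen X lam ((∑ j ∈ Finset.range (k + 1),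
        uElt (X.neg i) (m - j - 1) * lambdaElt (simpleCoroot b i) j) * a)
  | xZero (i : b.support) (k : ℕ) (hk : lam ((rootSystem H).coroot i, 0) = k)
      (r : ℕ) (hr : 1 ≤ r) (m : ℕ) (hm : k < m) (a : ULoop g) (ha : a ∈ uZero H) :
      LoopGen X lam (PowerSeries.coeff m
        (xZeroSeries (X.neg i) ^ r * lambdaSeries (simpleCoroot b i) 1) * a)
  | pos (i : b.support) (m : ℤ) : LoopGen X lam (uElt (X.pos i) m)

/-- The left ideal `Ĩ_λ` of `U(L(𝔤))`. -/
def loopIdeal (X : RootVectors b) (lam : Dual ℂ (H × ℂ)) : Submodule (ULoop g) (ULoop g) :=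
  Submodule.span _ {u | LoopGen X lam u}

/-- The left ideal `Ĩᵉ_λ` of `U(Lᵉ(𝔤))`, generated by `Ĩ_λ` and `d - λ(d)`. -/
def extIdeal (X : RootVectors b) (lam : Dual ℂ (H × ℂ)) : Submodule (UExt g) (UExt g) :=
  Submodule.span _ (uIncl g '' (loopIdeal X lam) ∪
    {UniversalEnvelopingAlgebra.ι ℂ (extD g) - algebraMap ℂ _ (lam (0, 1))})

/-- `W(λ) = U(Lᵉ(𝔤)) / Ĩᵉ_λ`, a left `U(Lᵉ(𝔤))`-module. -/
abbrev W (X : RootVectors b) (lam : Dual ℂ (H × ℂ)) := UExt g ⧸ extIdeal X lam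

/-- `U(L(𝔤)) / Ĩ_λ`, the same module `W(λ)` regarded as a left `U(L(𝔤))`-module. -/
abbrev WLoop (X : RootVectors b) (lam : Dual ℂ (H × ℂ)) := ULoop g ⧸ loopIdeal X lam

section RightAction

theorem expSeries_coeff_mem {A : Type*} [Ring A] [Algebra ℂ A] (S : Subalgebra ℂ A)
    (F : PowerSeries A) (hF : ∀ m, PowerSeries.coeff m F ∈ S) (m : ℕ) :
    PowerSeries.coeff m (expSeries F) ∈ S := by
  have hpow : ∀ n m : ℕ, PowerSeries.coeff m (F ^ n) ∈ S := by
    intro n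
    induction n with
    | zero =>
      intro m
      rw [pow_zero, PowerSeries.coeff_one]
      split_ifs
      exacts [S.one_mem, S.zero_mem]
    | succ n ih =>
      intro m
      rw [pow_succ, PowerSeries.coeff_mul]
      exact S.sum_mem fun p _ => S.mul_mem (ih _) (hF _)
  rw [expSeries, PowerSeries.coeff_mk]
  exact S.sum_mem fun n _ => S.smul_mem (hpow n m) _

theorem lambdaSeries_coeff_mem (i : b.support) (ε : ℤ) (hε : ε ≠ 0) (m : ℕ) :
    PowerSeries.coeff m (lambdaSeries (simpleCoroot b i) ε) ∈ uZero H := by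
  refine expSeries_coeff_mem _ _ (fun k => ?_) m
  rw [PowerSeries.coeff_mk]
  split_ifs with hk
  · exact Subalgebra.zero_mem _
  · refine Subalgebra.neg_mem _ (Subalgebra.smul_mem _ (Algebra.subset_adjoin ?_) _)
    exact ⟨i, ε * k, mul_ne_zero hε (by exact_mod_cast hk), rfl⟩

theorem lambdaElt_mem (i : b.support) (m : ℤ) : lambdaElt (simpleCoroot b i) m ∈ uZero H := by
  unfold lambdaElt
  exact lambdaSeries_coeff_mem i _ (by split_ifs <;> decide) _

theorem uElt_comm (x y : H) (m n : ℤ) :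
    uElt (x : g) m * uElt (y : g) n = uElt (y : g) n * uElt (x : g) m := by
  have h : ⁅(x : g), (y : g)⁆ = 0 := by
    rw [← LieSubalgebra.coe_bracket, trivial_lie_zero H H x y, ZeroMemClass.coe_zero]
  rw [uElt_mul, h]
  simp [uElt, loopElt]

theorem uZero_comm {a c : ULoop g} (ha : a ∈ uZero H) (hc : c ∈ uZero H) : a * c = c * a := by
  refine Algebra.commute_of_mem_adjoin_of_forall_mem_commute hc fun x hx => ?_
  refine (Algebra.commute_of_mem_adjoin_of_forall_mem_commute ha fun y hy => ?_).symm
  obtain ⟨α, m, -, rfl⟩ := hx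
  obtain ⟨β, n, -, rfl⟩ := hy
  exact uElt_comm _ _ _ _

/-- The left ideal `Ĩ_λ` is stable under right multiplication by `U(0)`. -/
theorem loopIdeal_mul_mem (X : RootVectors b) (lam : Dual ℂ (H × ℂ)) (a : ULoop g)
    (ha : a ∈ uZero H) (u : ULoop g) (hu : u ∈ loopIdeal X lam) : u * a ∈ loopIdeal X lam := by
  have gen : ∀ u, LoopGen X lam u → ∀ a ∈ uZero H, ∀ α : H.root, ∀ m : ℤ, m ≠ 0 →
      a = uElt ((rootSystem H).coroot α : g) m → u * a ∈ loopIdeal X lam := by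
    intro u hu a ha α m hm ham
    have hu' : u ∈ loopIdeal X lam := Submodule.subset_span hu
    have comm : u * a = a * u → u * a ∈ loopIdeal X lam := fun h => by
      rw [h]; exact Submodule.smul_mem _ a hu'
    cases hu with
    | cartan h =>
      apply comm
      rw [ham, sub_mul, mul_sub, uElt_comm, Algebra.commutes]
    | lambda i k hk m hm => exact comm (uZero_comm (lambdaElt_mem i m) ha)
    | lambda_mul i k hk m hm hmk =>
      exact comm (uZero_comm ((uZero H).sub_mem
        ((uZero H).mul_mem (lambdaElt_mem i _) (lambdaElt_mem i _)) (lambdaElt_mem i _)) ha)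
    | xTilde i k hk m a' ha' =>
      rw [mul_assoc]
      exact Submodule.subset_span (.xTilde i k hk m _ ((uZero H).mul_mem ha' ha))
    | xZero i k hk r hr m hm a' ha' =>
      rw [mul_assoc]
      exact Submodule.subset_span (.xZero i k hk r hr m hm _ ((uZero H).mul_mem ha' ha))
    | pos i n =>
      have hp := X.pos_mem i (b.isPos_of_mem_support i.2)
      have hl : ⁅((rootSystem H).coroot α : g), X.pos i⁆ =
          ((i : H.root) : LieModule.Weight ℂ H g) ((rootSystem H).coroot α) • X.pos i :=
        lie_eq_smul_of_mem_rootSpace hp ((rootSystem H).coroot α)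
      have e : uElt (X.pos i) n * a = a * uElt (X.pos i) n -
          ((i : H.root) : LieModule.Weight ℂ H g) ((rootSystem H).coroot α) •
            uElt (X.pos i) (m + n) := by
        rw [ham, uElt_mul ((rootSystem H).coroot α : g), hl]
        simp [uElt, loopElt]
      rw [e]
      refine Submodule.sub_mem _ (Submodule.smul_mem _ a hu') ?_
      rw [Algebra.smul_def]
      exact Submodule.smul_mem _ _ (Submodule.subset_span (.pos i (m + n)))
  induction ha using Algebra.adjoin_induction generalizing u with
  | mem a ha =>
    obtain ⟨α, m, hm, h⟩ := id ha
    induction hu using Submodule.span_induction with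
    | mem u hu => exact gen u hu a (Algebra.subset_adjoin ha) α m hm h
    | zero => rw [zero_mul]; exact Submodule.zero_mem _
    | add u v _ _ hu hv => rw [add_mul]; exact Submodule.add_mem _ hu hv
    | smul c u _ hu => rw [smul_eq_mul, mul_assoc]; exact Submodule.smul_mem _ c hu
  | algebraMap r =>
    rw [← Algebra.commutes]
    exact Submodule.smul_mem _ (algebraMap ℂ (ULoop g) r) hu
  | add a c _ _ ha hc => rw [mul_add]; exact Submodule.add_mem _ (ha u hu) (hc u hu)
  | mul a c _ _ ha hc => rw [← mul_assoc]; exact hc _ (ha u hu)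

/-- The right action of `a ∈ U(0)` on `W(λ) = U(L(𝔤)) / Ĩ_λ`, induced by `u ↦ u a`. It commutes
with the left action of `U(L(𝔤))`. -/
def rightMul (X : RootVectors b) (lam : Dual ℂ (H × ℂ)) (a : uZero H) :
    WLoop X lam →ₗ[ULoop g] WLoop X lam :=
  (loopIdeal X lam).mapQ (loopIdeal X lam)
    (LinearMap.toSpanSingleton (ULoop g) (ULoop g) (a : ULoop g))
    fun u hu => loopIdeal_mul_mem X lam a a.2 u hu

theorem rightMul_mk (X : RootVectors b) (lam : Dual ℂ (H × ℂ)) (a : uZero H) (u : ULoop g) :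
    rightMul X lam a ((loopIdeal X lam).mkQ u) = (loopIdeal X lam).mkQ (u * a) := rfl

end RightAction

/-- The weight `λ_{π,a} ∈ (𝔥ᵉ)*`, with `λ(h_i) = deg π_i` and `λ(d) = a`. -/
def weightOf (π : b.support → Polynomial ℂ) (a : ℂ) : Dual ℂ (H × ℂ) :=
  LinearMap.coprod (b.toCoweightBasis.constr ℂ fun i => ((π i).natDegree : ℂ))
    (LinearMap.toSpanSingleton ℂ ℂ a)

theorem weightOf_coroot (π : b.support → Polynomial ℂ) (a : ℂ) (i : b.support) :
    weightOf π a ((rootSystem H).coroot i, 0) = (π i).natDegree := by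
  rw [weightOf, LinearMap.coprod_apply, map_zero, add_zero, ← b.toCoweightBasis_apply,
    Basis.constr_basis]

theorem weightOf_d (π : b.support → Polynomial ℂ) (a : ℂ) : weightOf π a (0, 1) = a := by
  simp [weightOf]

/-- `π⁻(u)`, the quotient of `u ^ (deg π) π(u⁻¹)` by its constant term. -/
def minusPoly (p : Polynomial ℂ) : Polynomial ℂ :=
  Polynomial.C (p.reverse.coeff 0)⁻¹ * p.reverse

/-- The generators `(Λ_i^±(u) - π_i^±(u))_s` of the ideal `I_π(0)` of `U(0)`. -/
inductive ZeroGen (π : b.support → Polynomial ℂ) : uZero H → Prop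
  | plus (i : b.support) (s : ℕ) : ZeroGen π
      (⟨PowerSeries.coeff s (lambdaSeries (simpleCoroot b i) 1),
        lambdaSeries_coeff_mem i 1 (by decide) s⟩ - algebraMap ℂ _ ((π i).coeff s))
  | minus (i : b.support) (s : ℕ) : ZeroGen π
      (⟨PowerSeries.coeff s (lambdaSeries (simpleCoroot b i) (-1)),
        lambdaSeries_coeff_mem i (-1) (by decide) s⟩ -
          algebraMap ℂ _ ((minusPoly (π i)).coeff s))

/-- The ideal `I_π(0)` of the (commutative) algebra `U(0)`. -/
def zeroIdeal (π : b.support → Polynomial ℂ) : Submodule (uZero H) (uZero H) :=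
  Submodule.span _ {a | ZeroGen π a}

/-- `ℂ_π = U(0) / I_π(0)`. -/
abbrev CPi (π : b.support → Polynomial ℂ) := uZero H ⧸ zeroIdeal π

/-- The relations `w a ⊗ c = w ⊗ a c` (`a ∈ U(0)`) defining the tensor product over `U(0)` as a
quotient of the tensor product over `ℂ`. Their linear span is stable under `U(L(𝔤))`, as the
right action of `U(0)` commutes with the left action of `U(L(𝔤))`. -/
def balancing (X : RootVectors b) (π : b.support → Polynomial ℂ) (a : ℂ) :
    Submodule (ULoop g) (WLoop X (weightOf π a) ⊗[ℂ] CPi π) :=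
  Submodule.span _ {z | ∃ (w : WLoop X (weightOf π a)) (x : uZero H) (c : CPi π),
    z = rightMul X _ x w ⊗ₜ[ℂ] c - w ⊗ₜ[ℂ] (x • c)}

/-- The Weyl module `W(π) = W(λ_{π,a}) ⊗_{U(0)} ℂ_π`, a left `U(L(𝔤))`-module. -/
abbrev WPi (X : RootVectors b) (π : b.support → Polynomial ℂ) (a : ℂ) :=
  (WLoop X (weightOf π a) ⊗[ℂ] CPi π) ⧸ balancing X π a

end WeylModule

end

open WeylModule

noncomputable section

namespace WeylModule

open LieAlgebra LieAlgebra.IsKilling Module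

attribute [local instance 100] LieRing.ofAssociativeRing

/-! ### Generators of the enveloping algebras, and an sl₂ string lemma -/

section General

/-! Both W(λ) and W(π) are generated over L(𝔤) by a vector w of integral weight that is killed by
all x⁺_{i,m} and by a power of each x⁻_{i,0}. That power comes from the coefficient of u^(k+1) in
X⁻(u)^(k+1) Λ⁺(u), k = λ(h_i), which is just (x⁻_{i,0})^(k+1). `IsIntegrableHighestWeight` records
these properties, and most of the argument uses nothing else.

Since x_i^± are ad-nilpotent and nilpotent at the generator, x_i^± ⊗ 1 act locally nilpotently on
all of V. Weights of V lie in λ − Q⁺, and sl₂ theory makes the set of weights stable under the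
simple reflections (`reflection_weight`). Such a set is finite (`finite_of_reflection_stable`): the
orbit sum of a weight under the finite group G generated by the simple reflections is zero, so the
elements λ − wμ of Q⁺ add up to |G|λ, which bounds each of them. With finitely many weights every
root vector x_α^± ⊗ t^m is locally nilpotent, in particular e_0^±. Together with the weight
decomposition for 𝔥 ⊕ ℂd this is (i).

For (ii), the Λ_i^± act on w by the coefficients of π_i^±, so by taking logarithms every h ⊗ t^m
preserves the line ℂw. The relation with X̃⁻_i becomes a linear recurrence for m ↦ x⁻_{i,m} w, that
is, a nonzero Laurent polynomial annihilating x⁻_i at w. Elements of 𝔤 with such an annihilator form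
a Lie subalgebra, hence are all of 𝔤, and a common multiple p satisfies (pℂ[t,t⁻¹] ⊗ 𝔤)V = 0
(`exists_laurentAction_eq_zero`). The operators x⁻_{i,m} therefore span a finite-dimensional space
F. Now V is the sum of the spaces F^r w, each finite-dimensional, and F^r w = 0 for large r because
it lies at height r below λ and there are finitely many weights. -/

theorem adjoin_range_ι_eq_top (L : Type*) [LieRing L] [LieAlgebra ℂ L] :
    Algebra.adjoin ℂ (Set.range (UniversalEnvelopingAlgebra.ι ℂ : L → _)) = ⊤ := by
  set S := Algebra.adjoin ℂ (Set.range (UniversalEnvelopingAlgebra.ι ℂ : L → _))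
  let f : L →ₗ⁅ℂ⁆ S :=
    { toFun := fun x => ⟨UniversalEnvelopingAlgebra.ι ℂ x, Algebra.subset_adjoin ⟨x, rfl⟩⟩
      map_add' := fun x y => Subtype.ext (by simp)
      map_smul' := fun c x => Subtype.ext (by simp)
      map_lie' := fun {x y} => Subtype.ext (by simp [LieRing.of_associative_ring_bracket]) }
  -- The universal property retracts the enveloping algebra onto S, so the inclusion of S is
  -- surjective.
  have h : S.val.comp (UniversalEnvelopingAlgebra.lift ℂ f) = AlgHom.id ℂ _ := by
    apply UniversalEnvelopingAlgebra.hom_ext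
    ext x
    simp [f]
  refine eq_top_iff.2 fun u _ => ?_
  have := congrArg (fun φ => φ u) h
  simp only [AlgHom.comp_apply, AlgHom.id_apply] at this
  rw [← this]
  exact (UniversalEnvelopingAlgebra.lift ℂ f u).2

/-- If `m` has non-negative integral weight `n` and `e` is nilpotent at `m`, then raising `m` to a
primitive vector and lowering it gives a nonzero vector of weight `-n`. -/
theorem exists_pow_toEnd_ne_zero {L M : Type*} [LieRing L] [LieAlgebra ℂ L] [AddCommGroup M]
    [Module ℂ M] [LieRingModule L M] [LieModule ℂ L M] {h e f : L} (t : IsSl2Triple h e f)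
    {m : M} (hm : m ≠ 0) (n : ℕ) (hn : ⁅h, m⁆ = (n : ℂ) • m)
    (he : ∃ N, (LieModule.toEnd ℂ L M e ^ N) m = 0) :
    ∃ p : ℕ, (LieModule.toEnd ℂ L M f ^ (p + n)) ((LieModule.toEnd ℂ L M e ^ p) m) ≠ 0 := by
  -- Here p is an exponent with e^p m ≠ 0 and e^(p+1) m = 0. This vector is primitive of weight n +
  -- 2p, so f^q does not kill it for q ≤ n + 2p, in particular for q = p + n.
  obtain ⟨p, hp, hp'⟩ := Nat.exists_not_and_succ_of_not_zero_of_exists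
    (p := fun N => (LieModule.toEnd ℂ L M e ^ N) m = 0) (by simpa using hm) he
  have P : t.HasPrimitiveVectorWith ((LieModule.toEnd ℂ L M e ^ p) m) ((n : ℂ) + 2 * p) :=
    { ne_zero := hp
      lie_h := t.lie_h_pow_toEnd_e hn p
      lie_e := by rw [IsSl2Triple.lie_e_pow_toEnd_e]; exact hp' }
  exact ⟨p, P.pow_toEnd_f_ne_zero_of_eq_nat (n := n + 2 * p) (by push_cast; ring) (by omega)⟩

variable {g : Type*} [LieRing g] [LieAlgebra ℂ g]

theorem loop_span_eq_top :
    Submodule.span ℂ (Set.range fun p : ℤ × g => loopElt p.2 p.1) = ⊤ := by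
  refine eq_top_iff.2 fun z _ => ?_
  induction z using TensorProduct.induction_on with
  | zero => exact Submodule.zero_mem _
  | add x y hx hy => exact Submodule.add_mem _ (hx trivial) (hy trivial)
  | tmul p x =>
    induction p using AddMonoidAlgebra.induction_linear with
    | zero => rw [TensorProduct.zero_tmul]; exact Submodule.zero_mem _
    | add a a' h h' =>
      rw [TensorProduct.add_tmul]
      exact Submodule.add_mem _ (h trivial) (h' trivial)
    | single m c =>
      have : (AddMonoidAlgebra.single m c : AddMonoidAlgebra ℂ ℤ) ⊗ₜ[ℂ] x =
          c • loopElt x m := by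
        rw [loopElt, TensorProduct.smul_tmul', AddMonoidAlgebra.smul_single, smul_eq_mul, mul_one]
      rw [this]
      exact Submodule.smul_mem _ _ (Submodule.subset_span ⟨(m, x), rfl⟩)

theorem loopElt_add (x y : g) (m : ℤ) : loopElt (x + y) m = loopElt x m + loopElt y m :=
  TensorProduct.tmul_add _ _ _

theorem loopElt_smul (c : ℂ) (x : g) (m : ℤ) : loopElt (c • x) m = c • loopElt x m :=
  TensorProduct.tmul_smul _ _ _

theorem uElt_add (x y : g) (m : ℤ) : uElt (x + y) m = uElt x m + uElt y m := by
  rw [uElt, loopElt_add, map_add]; rfl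

theorem uElt_smul (c : ℂ) (x : g) (m : ℤ) : uElt (c • x) m = c • uElt x m := by
  rw [uElt, loopElt_smul, map_smul]; rfl

theorem uElt_zero (m : ℤ) : uElt (0 : g) m = 0 := by
  simpa using uElt_smul (0 : ℂ) (0 : g) m

theorem subalgebra_eq_top_of_uElt_mem (S : Subalgebra ℂ (ULoop g)) (h : ∀ x m, uElt x m ∈ S) :
    S = ⊤ := by
  rw [eq_top_iff, ← adjoin_range_ι_eq_top, Algebra.adjoin_le_iff]
  rintro _ ⟨z, rfl⟩
  have hz : z ∈ Submodule.span ℂ (Set.range fun p : ℤ × g => loopElt p.2 p.1) := by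
    rw [loop_span_eq_top]; trivial
  induction hz using Submodule.span_induction with
  | mem z hz => obtain ⟨p, rfl⟩ := hz; exact h _ _
  | zero => rw [map_zero]; exact Subalgebra.zero_mem _
  | add x y _ _ hx hy => rw [map_add]; exact Subalgebra.add_mem _ hx hy
  | smul c x _ hx => rw [map_smul]; exact Subalgebra.smul_mem _ hx c

theorem uIncl_ι (z : Loop g) : uIncl g (UniversalEnvelopingAlgebra.ι ℂ z) =
    UniversalEnvelopingAlgebra.ι ℂ (loopIncl g z) := by
  rw [uIncl, UniversalEnvelopingAlgebra.lift_ι_apply, LieHom.comp_apply]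

theorem uIncl_uElt (x : g) (m : ℤ) : uIncl g (uElt x m) = uExtElt x m := uIncl_ι _

theorem exists_eq_loopIncl_add_smul_extD (z : ExtLoop g) :
    ∃ (x : Loop g) (c : ℂ), z = loopIncl g x + c • extD g := by
  refine ⟨SemiDirectSum.left z, SemiDirectSum.right z, SemiDirectSum.ext ?_ ?_⟩
  · change SemiDirectSum.left z = SemiDirectSum.left z + SemiDirectSum.right z • (0 : Loop g)
    rw [smul_zero, add_zero]
  · change SemiDirectSum.right z = (0 : ℂ) + SemiDirectSum.right z • (1 : ℂ)
    rw [smul_eq_mul, mul_one, zero_add]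

theorem subalgebra_eq_top_of_uExtElt_mem (S : Subalgebra ℂ (UExt g))
    (h : ∀ x m, uExtElt x m ∈ S) (hd : UniversalEnvelopingAlgebra.ι ℂ (extD g) ∈ S) :
    S = ⊤ := by
  have key : S.comap (uIncl g) = ⊤ :=
    subalgebra_eq_top_of_uElt_mem _ fun x m => by
      rw [Subalgebra.mem_comap, uIncl_uElt]
      exact h x m
  rw [eq_top_iff, ← adjoin_range_ι_eq_top, Algebra.adjoin_le_iff]
  rintro _ ⟨z, rfl⟩
  obtain ⟨x, c, rfl⟩ := exists_eq_loopIncl_add_smul_extD z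
  rw [map_add, map_smul, ← uIncl_ι]
  refine Subalgebra.add_mem _ ?_ (Subalgebra.smul_mem _ hd _)
  have : UniversalEnvelopingAlgebra.ι ℂ x ∈ S.comap (uIncl g) := key ▸ Algebra.mem_top
  exact this

end General

/-! ### Finiteness of reflection-stable sets of weights -/

section Roots

variable {ι R M N : Type*} [Finite ι] [CommRing R] [AddCommGroup M] [Module R M]
  [AddCommGroup N] [Module R N]

/-- The roots span, so an automorphism is determined by its permutation of the finitely many roots.
-/
theorem finite_aut (P : RootPairing ι R M N) [P.IsRootSystem] : Finite P.Aut := by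
  refine Finite.of_injective (fun g : P.Aut => g.indexEquiv) fun g g' h => ?_
  apply RootPairing.Equiv.weightHom_injective P
  ext x
  change g • x = g' • x
  have hx : x ∈ Submodule.span R (Set.range P.root) := by
    rw [RootPairing.IsRootSystem.span_root_eq_top]; trivial
  induction hx using Submodule.span_induction with
  | mem x hx =>
    obtain ⟨i, rfl⟩ := hx
    rw [← RootPairing.Equiv.root_indexEquiv_eq_smul, ← RootPairing.Equiv.root_indexEquiv_eq_smul]
    exact congrArg (fun e : ι ≃ ι => P.root (e i)) h
  | zero => simp
  | add x y _ _ hx hy => rw [smul_add, smul_add, hx, hy]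
  | smul c x _ hx =>
    change RootPairing.Equiv.weightHom P g (c • x) = RootPairing.Equiv.weightHom P g' (c • x)
    rw [map_smul, map_smul]
    exact congrArg (c • ·) hx

omit [Finite ι] in
theorem repr_mem_of_mem_closure {P : RootPairing ι R M N} [P.IsRootSystem] (b : P.Base) {q : M}
    (hq : q ∈ AddSubmonoid.closure (P.root '' b.support)) (i : b.support) :
    ∃ k : ℕ, b.toWeightBasis.repr q i = k := by
  classical
  induction hq using AddSubmonoid.closure_induction with
  | mem q hq =>
    obtain ⟨j, hj, rfl⟩ := hq
    have := b.toWeightBasis_repr_root ⟨j, hj⟩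
    rw [this, Finsupp.single_apply]
    split_ifs
    exacts [⟨1, by simp⟩, ⟨0, by simp⟩]
  | zero => exact ⟨0, by simp⟩
  | add x y _ _ hx hy =>
    obtain ⟨k, hk⟩ := hx
    obtain ⟨l, hl⟩ := hy
    exact ⟨k + l, by simp [hk, hl]⟩

/-- In the basis of simple roots, q has natural coordinates bounded by those of c. If some
coordinate of c is not a natural number, no q qualifies. -/
theorem finite_root_interval [CharZero R] {P : RootPairing ι R M N} [P.IsRootSystem]
    (b : P.Base) (c : M) :
    {q | q ∈ AddSubmonoid.closure (P.root '' b.support) ∧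
      c - q ∈ AddSubmonoid.closure (P.root '' b.support)}.Finite := by
  by_cases hc : ∀ i, ∃ k : ℕ, b.toWeightBasis.repr c i = k
  · choose k hk using hc
    have hfin : (Set.pi Set.univ fun i => Nat.cast '' Set.Iic (k i) : Set (b.support → R)).Finite :=
      Set.Finite.pi fun i => (Set.finite_Iic _).image _
    refine (hfin.preimage (f := fun q => ⇑(b.toWeightBasis.repr q)) fun x _ y _ h => ?_).subset ?_
    · exact b.toWeightBasis.repr.injective (DFunLike.coe_injective h)
    · rintro q ⟨hq, hq'⟩ i -
      obtain ⟨a, ha⟩ := repr_mem_of_mem_closure b hq i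
      obtain ⟨a', ha'⟩ := repr_mem_of_mem_closure b hq' i
      refine ⟨a, ?_, ha.symm⟩
      rw [map_sub, Finsupp.sub_apply, hk, ha, sub_eq_iff_eq_add] at ha'
      have : k i = a' + a := by exact_mod_cast ha'
      simp only [Set.mem_Iic]
      omega
  · push Not at hc
    obtain ⟨i, hi⟩ := hc
    convert Set.finite_empty
    ext q
    simp only [Set.mem_ofPred_eq, Set.mem_empty_iff_false, iff_false, not_and]
    intro hq hq'
    obtain ⟨a, ha⟩ := repr_mem_of_mem_closure b hq i
    obtain ⟨a', ha'⟩ := repr_mem_of_mem_closure b hq' i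
    apply hi (a' + a)
    rw [map_sub, Finsupp.sub_apply, ha, sub_eq_iff_eq_add] at ha'
    simpa using ha'

/-- A set of weights below `lam` that is stable under the simple reflections is finite. -/
theorem finite_of_reflection_stable {K V W : Type*} [Field K] [CharZero K] [AddCommGroup V]
    [Module K V] [AddCommGroup W] [Module K W] {P : RootPairing ι K V W} [P.IsRootSystem]
    (b : P.Base) (lam : V) (S : Set V)
    (hS : ∀ μ ∈ S, lam - μ ∈ AddSubmonoid.closure (P.root '' b.support))
    (hr : ∀ i ∈ b.support, ∀ μ ∈ S, P.reflection i μ ∈ S) : S.Finite := by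
  classical
  let G : Subgroup P.Aut := Subgroup.closure (RootPairing.Equiv.reflection P '' b.support)
  have : Finite P.Aut := finite_aut P
  have : Fintype G := Fintype.ofFinite G
  have hGS : ∀ w ∈ G, ∀ μ ∈ S, w • μ ∈ S := by
    intro w hw
    induction hw using Subgroup.closure_induction_left with
    | one => intro μ hμ; rwa [one_smul]
    | mul_left x hx y _ ih =>
      obtain ⟨i, hi, rfl⟩ := hx
      intro μ hμ
      rw [mul_smul, RootPairing.Equiv.reflection_smul]
      exact hr i hi _ (ih μ hμ)
    | inv_mul_cancel x hx y _ ih =>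
      obtain ⟨i, hi, rfl⟩ := hx
      intro μ hμ
      rw [RootPairing.Equiv.reflection_inv, mul_smul, RootPairing.Equiv.reflection_smul]
      exact hr i hi _ (ih μ hμ)
  -- The sum is fixed by every simple reflection, so it pairs to zero with the simple coroots, which
  -- form a basis.
  have hsum : ∀ μ : V, ∑ w : G, (w : P.Aut) • μ = 0 := by
    intro μ
    set x := ∑ w : G, (w : P.Aut) • μ with hx
    have hfix : ∀ i ∈ b.support, P.toLinearMap x (P.coroot i) = 0 := by
      intro i hi
      let s : G := ⟨RootPairing.Equiv.reflection P i, Subgroup.subset_closure ⟨i, hi, rfl⟩⟩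
      have h1 : (s : P.Aut) • x = x := by
        rw [hx, Finset.smul_sum]
        refine Fintype.sum_equiv (Equiv.mulLeft s) _ _ fun w => ?_
        rw [Equiv.coe_mulLeft, Subgroup.coe_mul, mul_smul]
      have h2 : P.reflection i x = x := h1
      rw [RootPairing.reflection_apply, sub_eq_self, smul_eq_zero] at h2
      exact h2.resolve_right (P.ne_zero i)
    have h0 : P.toLinearMap x = 0 := by
      refine b.toCoweightBasis.ext fun i => ?_
      rw [b.toCoweightBasis_apply, hfix i i.2, LinearMap.zero_apply]
    exact P.toPerfPair.injective (by rw [map_zero]; exact h0)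
  -- This is |G| · lam. As orbit sums vanish, it equals the sum of all lam − wμ; removing the term w
  -- = 1 leaves a sum of elements of the positive cone, so lam − μ lies in the interval below c.
  let c : V := ∑ _w : G, lam
  have hc : ∀ μ ∈ S, c - (lam - μ) ∈ AddSubmonoid.closure (P.root '' b.support) := by
    intro μ hμ
    have h1 : c = ∑ w : G, (lam - (w : P.Aut) • μ) := by
      rw [Finset.sum_sub_distrib, hsum, sub_zero]
    have h2 : c - (lam - μ) = ∑ w ∈ Finset.univ.erase (1 : G), (lam - (w : P.Aut) • μ) := by
      rw [h1, ← Finset.add_sum_erase _ _ (Finset.mem_univ (1 : G))]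
      simp
    rw [h2]
    exact AddSubmonoid.sum_mem _ fun w _ => hS _ (hGS w w.2 μ hμ)
  refine ((finite_root_interval b c).preimage (f := fun μ => lam - μ)
    fun x _ y _ h => sub_right_injective h).subset fun μ hμ => ⟨hS μ hμ, hc μ hμ⟩

end Roots

/-! ### Generation of 𝔤 by 𝔥 and the simple root vectors -/

section Generation

variable {g : Type*} [LieRing g] [LieAlgebra ℂ g] [FiniteDimensional ℂ g] [IsKilling ℂ g]
variable {H : LieSubalgebra ℂ g} [H.IsCartanSubalgebra]

open LieModule in
theorem rootSpace_le_of_mem (K : LieSubalgebra ℂ g) (β : Weight ℂ H g) (hβ : β.IsNonZero) {y : g}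
    (hy : y ∈ rootSpace H β) (hy0 : y ≠ 0) (hK : y ∈ K) : ∀ x ∈ rootSpace H β, x ∈ K := by
  intro x hx
  have h1 := finrank_rootSpace_eq_one β hβ
  have hy0' : (⟨y, hy⟩ : rootSpace H β) ≠ 0 := fun h => hy0 (congrArg Subtype.val h)
  obtain ⟨c, hc⟩ := (finrank_eq_one_iff_of_nonzero' _ hy0').1 h1 ⟨x, hx⟩
  have : c • y = x := congrArg Subtype.val hc
  rw [← this]
  exact K.smul_mem c hK

-- Root spaces are one-dimensional, so one nonzero element of K in the reflected root space
-- suffices. For n = β(α^∨) ≥ 0 and 0 ≠ y ∈ 𝔤_β, some f^(p+n) e^p y is nonzero; it has weight β − nα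
-- and stays in K.
open LieModule in
theorem rootSpace_reflection_le (K : LieSubalgebra ℂ g) (α β γ : Weight ℂ H g)
    (hα : α.IsNonZero) (hγ : γ.IsNonZero) {e f : g} (he : e ∈ rootSpace H α)
    (hf : f ∈ rootSpace H (-α)) (t : IsSl2Triple (coroot α : g) e f) (heK : e ∈ K) (hfK : f ∈ K)
    (hβ : ∀ x ∈ rootSpace H β, x ∈ K) (h : (γ : H → ℂ) = β - β (coroot α) • (α : H → ℂ)) :
    ∀ x ∈ rootSpace H γ, x ∈ K := by
  have main : ∀ (α : Weight ℂ H g) (e f : g), α.IsNonZero → e ∈ rootSpace H α →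
      f ∈ rootSpace H (-α) → IsSl2Triple (coroot α : g) e f → e ∈ K → f ∈ K →
      (γ : H → ℂ) = β - β (coroot α) • (α : H → ℂ) → (∃ n : ℕ, β (coroot α) = n) →
      ∀ x ∈ rootSpace H γ, x ∈ K := by
    rintro α e f hα he hf t heK hfK h ⟨n, hn⟩
    obtain ⟨y, hy, hy0⟩ := β.exists_ne_zero
    have hpow : ∀ (z : g), z ∈ K → ∀ (p : ℕ) (v : g), v ∈ K → (toEnd ℂ g g z ^ p) v ∈ K := by
      intro z hz p
      induction p with
      | zero => intro v hv; simpa using hv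
      | succ p ih =>
        intro v hv
        rw [pow_succ, Module.End.mul_apply]
        exact ih _ (K.lie_mem hz hv)
    have hnil : ∃ N, (toEnd ℂ g g e ^ N) y = 0 := by
      obtain ⟨N, hN⟩ := LieAlgebra.isNilpotent_ad_of_mem_rootSpace H
        (χ := (α : H → ℂ)) (fun h => hα h) he
      refine ⟨N, ?_⟩
      change (ad ℂ g e ^ N) y = 0
      rw [hN, LinearMap.zero_apply]
    obtain ⟨p, hp⟩ := exists_pow_toEnd_ne_zero t hy0 n
      (by rw [← hn]; exact lie_eq_smul_of_mem_rootSpace hy (coroot α)) hnil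
    refine rootSpace_le_of_mem K γ hγ ?_ hp (hpow f hfK _ _ (hpow e heK _ _ (hβ y hy)))
    have h1 := LieAlgebra.toEnd_pow_apply_mem hf (LieAlgebra.toEnd_pow_apply_mem he hy p) (p + n)
    convert! h1 using 3
    rw [h, hn]
    ext x
    simp only [Pi.sub_apply, Pi.smul_apply, Pi.add_apply, Pi.neg_apply, smul_eq_mul,
      nsmul_eq_mul, Pi.mul_apply, Pi.natCast_apply]
    push_cast
    ring
  have hint : ∃ z : ℤ, β (coroot α) = z := ⟨_, apply_coroot_eq_cast α β⟩
  obtain ⟨z, hz⟩ := hint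
  rcases Int.eq_nat_or_neg z with ⟨n, rfl | rfl⟩
  · exact main α e f hα he hf t heK hfK h ⟨n, by simpa using hz⟩
  -- A negative value of β on the coroot is made non-negative by passing to −α, which exchanges e
  -- and f and leaves the reflection unchanged.
  · have hc : coroot (-α) = -coroot α := coroot_neg α
    refine main (-α) f e hα.neg hf (by simpa using he) ?_ hfK heK ?_ ⟨n, ?_⟩
    · rw [hc]; simpa using t
    · rw [h, hc]
      have : β (-coroot α) = -β (coroot α) := β.toLinear.map_neg _
      rw [this]
      simp
    · have : β (-coroot α) = -β (coroot α) := β.toLinear.map_neg _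
      rw [hc, this, hz]
      simp

variable {b : (rootSystem H).Base}

/-- The Cartan subalgebra and the simple root vectors generate the Lie algebra. -/
theorem eq_top_of_simple_mem (X : RootVectors b) (K : LieSubalgebra ℂ g)
    (hH : ∀ h : H, (h : g) ∈ K) (hp : ∀ i : b.support, X.pos i ∈ K)
    (hn : ∀ i : b.support, X.neg i ∈ K) : K = ⊤ := by
  have hroot : ∀ β : H.root, (∀ x ∈ rootSpace H (β : LieModule.Weight ℂ H g), x ∈ K) ∧
      ∀ x ∈ rootSpace H (-(β : LieModule.Weight ℂ H g)), x ∈ K := by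
    intro β
    have hco : ∀ β : H.root, (β : LieModule.Weight ℂ H g).IsNonZero := fun β =>
      H.isNonZero_coe_root β
    have href : ∀ i j : H.root, (((rootSystem H).reflectionPerm j i : H.root) :
        LieModule.Weight ℂ H g).toLinear = (i : LieModule.Weight ℂ H g).toLinear -
          (i : LieModule.Weight ℂ H g) (coroot (j : LieModule.Weight ℂ H g)) •
            (j : LieModule.Weight ℂ H g).toLinear := by
      intro i j
      have := (rootSystem H).root_reflectionPerm j i
      rw [RootPairing.reflection_apply_root] at this
      exact this
    have hcoe : ∀ i j : H.root, ((((rootSystem H).reflectionPerm j i : H.root) :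
        LieModule.Weight ℂ H g) : H → ℂ) = (i : LieModule.Weight ℂ H g) -
          (i : LieModule.Weight ℂ H g) (coroot (j : LieModule.Weight ℂ H g)) •
            ((j : LieModule.Weight ℂ H g) : H → ℂ) := by
      intro i j
      ext x
      exact congrArg (fun φ : Dual ℂ H => φ x) (href i j)
    -- The root spaces of β and −β are treated together, so the induction step for negation is a
    -- swap.
    refine b.induction_reflect (p := fun β : H.root =>
      (∀ x ∈ rootSpace H (β : LieModule.Weight ℂ H g), x ∈ K) ∧
        ∀ x ∈ rootSpace H (-(β : LieModule.Weight ℂ H g)), x ∈ K) β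
      (fun i hi => ?_) (fun i hi => ?_) (fun i j hi hj => ?_)
    · have : ((((rootSystem H).reflectionPerm i i : H.root) : LieModule.Weight ℂ H g) : H → ℂ) =
          -(i : LieModule.Weight ℂ H g) := by
        rw [hcoe, root_apply_coroot (hco i), two_smul]
        abel
      have h2 : -((((rootSystem H).reflectionPerm i i : H.root) : LieModule.Weight ℂ H g) : H → ℂ) =
          (i : LieModule.Weight ℂ H g) := by rw [this, neg_neg]
      rw [this, neg_neg]
      exact ⟨hi.2, hi.1⟩
    · have hpos := b.isPos_of_mem_support hi
      exact ⟨rootSpace_le_of_mem K _ (hco i) (X.pos_mem i hpos) (X.sl2 i hpos).e_ne_zero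
          (hp ⟨i, hi⟩),
        rootSpace_le_of_mem K (-i.1) (hco i).neg (X.neg_mem i hpos) (X.sl2 i hpos).f_ne_zero
          (hn ⟨i, hi⟩)⟩
    · have hpos := b.isPos_of_mem_support hj
      have h1 := rootSpace_reflection_le K (j : LieModule.Weight ℂ H g) i
        ((rootSystem H).reflectionPerm j i : H.root) (hco j) (hco _) (X.pos_mem j hpos)
        (X.neg_mem j hpos) (X.sl2 j hpos) (hp ⟨j, hj⟩) (hn ⟨j, hj⟩) hi.1 (hcoe i j)
      have h2 := rootSpace_reflection_le K (j : LieModule.Weight ℂ H g) (-i.1)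
        (-((rootSystem H).reflectionPerm j i : H.root).1) (hco j) (hco _).neg (X.pos_mem j hpos)
        (X.neg_mem j hpos) (X.sl2 j hpos) (hp ⟨j, hj⟩) (hn ⟨j, hj⟩) hi.2 (by
          rw [LieModule.Weight.coe_neg, LieModule.Weight.coe_neg, hcoe, Pi.neg_apply, neg_smul]
          abel)
      exact ⟨h1, h2⟩
  have htop := LieModule.iSup_genWeightSpace_eq_top' ℂ H g
  rw [eq_top_iff]
  intro x _
  have hx : x ∈ ⨆ χ : LieModule.Weight ℂ H g, LieModule.genWeightSpace g χ := by
    rw [htop]; trivial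
  induction hx using LieSubmodule.iSup_induction' with
  | mem χ x hx =>
    by_cases hχ : χ.IsZero
    · rw [hχ.eq] at hx
      have hx' : x ∈ rootSpace H (0 : H → ℂ) := hx
      rw [rootSpace_zero_eq] at hx'
      exact hH ⟨x, hx'⟩
    · exact (hroot ⟨χ, by simpa using hχ⟩).1 x hx
  | zero => exact K.zero_mem
  | add x y _ _ hx hy => exact K.add_mem (hx trivial) (hy trivial)

/-- The bracket has weight α_i − α_j, a difference of distinct simple roots, which is neither zero
nor a root. -/
theorem lie_pos_neg_of_ne (X : RootVectors b) {i j : b.support} (hij : i ≠ j) :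
    ⁅X.pos i, X.neg j⁆ = 0 := by
  have hi := b.isPos_of_mem_support i.2
  have hj := b.isPos_of_mem_support j.2
  have hm := LieAlgebra.lie_mem_genWeightSpace_of_mem_genWeightSpace (X.pos_mem i hi)
    (X.neg_mem j hj)
  by_contra h0
  have hne : rootSpace H (((i : H.root) : LieModule.Weight ℂ H g) +
      -((j : H.root) : LieModule.Weight ℂ H g) : H → ℂ) ≠ ⊥ := by
    intro h
    apply h0
    have hm' : ⁅X.pos i, X.neg j⁆ ∈ rootSpace H (((i : H.root) : LieModule.Weight ℂ H g) +
      -((j : H.root) : LieModule.Weight ℂ H g) : H → ℂ) := hm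
    rw [h] at hm'
    exact (LieSubmodule.mem_bot _).1 hm'
  let χ : LieModule.Weight ℂ H g := ⟨_, hne⟩
  have hχ : χ.toLinear = (rootSystem H).root i - (rootSystem H).root j := by
    ext x
    rw [sub_eq_add_neg]
    rfl
  by_cases hz : χ.IsZero
  · have : χ.toLinear = 0 := by
      ext x
      exact congrFun hz x
    rw [this, eq_comm, sub_eq_zero] at hχ
    exact hij (Subtype.ext ((rootSystem H).root.injective hχ))
  · exact b.sub_notMem_range_root i.2 j.2 ⟨⟨χ, by simpa using hz⟩, hχ⟩

theorem IsHighestRoot.isPos {θ : H.root} (hθ : IsHighestRoot b θ) : b.IsPos θ := by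
  classical
  obtain ⟨f, -, hf⟩ := b.exists_root_eq_sum_nat_or_neg θ
  rcases hf with hf | hf
  · rw [RootPairing.Base.isPos_iff', b.height_eq_sum (f := fun j => (f j : ℤ)) (by simpa using hf)]
    exact Finset.sum_nonneg fun j _ => Int.natCast_nonneg _
  · exfalso
    -- Comparing θ with its own negative puts 2θ in the positive cone; a negative θ would then have
    -- all coordinates zero.
    have h2 := hθ ((rootSystem H).reflectionPerm θ θ)
    rw [RootPairing.root_reflectionPerm, RootPairing.reflection_apply_self, sub_neg_eq_add] at h2
    have hrepr : ∀ i : b.support, b.toWeightBasis.repr ((rootSystem H).root θ) i = -(f i : ℂ) := by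
      intro i
      rw [hf, ← Finset.sum_coe_sort, map_neg, map_sum, Finsupp.neg_apply, Finsupp.finsetSum_apply]
      congr 1
      rw [Finset.sum_eq_single i]
      · rw [map_nsmul, b.toWeightBasis_repr_root]; simp
      · intro j _ hj
        rw [map_nsmul, b.toWeightBasis_repr_root]
        simp [hj]
      · simp
    apply (rootSystem H).ne_zero θ
    apply b.toWeightBasis.repr.injective
    ext i
    obtain ⟨k, hk⟩ := repr_mem_of_mem_closure b h2 i
    rw [map_add, Finsupp.add_apply, hrepr] at hk
    have h0 : k + 2 * f i = 0 := by
      have : ((k + 2 * f i : ℕ) : ℂ) = 0 := by push_cast; rw [← hk]; ring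
      exact_mod_cast this
    have hfi : f i = 0 := by omega
    rw [hrepr, hfi, map_zero, Finsupp.zero_apply, Nat.cast_zero, neg_zero]

end Generation

/-- Simultaneous eigenspaces lie in simultaneous generalized eigenspaces, which are independent for
a commuting family. No finiteness of V is needed. -/
theorem iSupIndep_iInf_eigenspace {V I E : Type*} [AddCommGroup V] [Module ℂ V]
    (f : E → Module.End ℂ V) (hf : ∀ i j, Commute (f i) (f j)) (φ : I → E → ℂ)
    (hφ : Function.Injective φ) :
    iSupIndep fun i => ⨅ h, (f h).eigenspace (φ i h) := by
  have h := Module.End.independent_iInf_maxGenEigenspace_of_forall_mapsTo f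
    fun i j c => Module.End.mapsTo_maxGenEigenspace_of_comm (hf j i) c
  have h2 : iSupIndep fun i => ⨅ e, (f e).maxGenEigenspace (φ i e) := h.comp hφ
  refine h2.mono fun i => iInf_mono fun e => ?_
  intro v hv
  rw [Module.End.mem_eigenspace_iff] at hv
  rw [Module.End.mem_maxGenEigenspace]
  exact ⟨1, by rw [pow_one, LinearMap.sub_apply, hv]; simp⟩

/-! ### Representations of the loop algebra: local nilpotency and 𝔥-weights -/

section Representation

variable {g : Type*} [LieRing g] [LieAlgebra ℂ g]
variable {V : Type*} [AddCommGroup V] [Module ℂ V] (ρ : ULoop g →ₐ[ℂ] Module.End ℂ V)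

theorem map_uElt_comm (x y : g) (m n : ℤ) (v : V) :
    ρ (uElt x m) (ρ (uElt y n) v) =
      ρ (uElt y n) (ρ (uElt x m) v) + ρ (uElt ⁅x, y⁆ (m + n)) v := by
  rw [← Module.End.mul_apply, ← map_mul, uElt_mul, map_add, map_mul, LinearMap.add_apply,
    Module.End.mul_apply]

theorem map_uElt_add (x y : g) (m : ℤ) (v : V) :
    ρ (uElt (x + y) m) v = ρ (uElt x m) v + ρ (uElt y m) v := by
  rw [uElt_add, map_add, LinearMap.add_apply]

theorem map_uElt_smul (c : ℂ) (x : g) (m : ℤ) (v : V) :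
    ρ (uElt (c • x) m) v = c • ρ (uElt x m) v := by
  rw [uElt_smul, map_smul, LinearMap.smul_apply]

theorem map_uElt_zero (m : ℤ) (v : V) : ρ (uElt (0 : g) m) v = 0 := by
  rw [uElt_zero, map_zero, LinearMap.zero_apply]

/-- The elements `x` of `g` such that all `x ⊗ t ^ m` preserve the subspace `N`. -/
def loopStabilizer (N : Submodule ℂ V) : LieSubalgebra ℂ g where
  carrier := {x | ∀ m, ∀ v ∈ N, ρ (uElt x m) v ∈ N}
  add_mem' := fun hx hy m v hv => by
    rw [map_uElt_add]; exact N.add_mem (hx m v hv) (hy m v hv)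
  zero_mem' := fun m v _ => by rw [map_uElt_zero]; exact N.zero_mem
  smul_mem' := fun c x hx m v hv => by
    rw [map_uElt_smul]; exact N.smul_mem c (hx m v hv)
  lie_mem' := fun {x y} hx hy m v hv => by
    have h := map_uElt_comm ρ x y m 0 v
    rw [add_zero, ← sub_eq_iff_eq_add'] at h
    rw [← h]
    exact N.sub_mem (hx m _ (hy 0 v hv)) (hy 0 _ (hx m v hv))

/-- The Lie algebra homomorphism giving the action of `g = g ⊗ 1`. -/
def constHom : g →ₗ⁅ℂ⁆ Module.End ℂ V where
  toFun x := ρ (uElt x 0)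
  map_add' x y := by rw [uElt_add, map_add]
  map_smul' c x := by rw [uElt_smul, map_smul, RingHom.id_apply]
  map_lie' := fun {x y} => by
    ext v
    have h := map_uElt_comm ρ x y 0 0 v
    rw [add_zero, ← sub_eq_iff_eq_add'] at h
    rw [← h, LieRing.of_associative_ring_bracket]
    rfl

variable {ρ}

/-- If `ad x` is nilpotent and `x ⊗ 1` acts nilpotently on a vector generating `V`, then `x ⊗ 1`
is locally nilpotent. -/
theorem locally_nilpotent_of_generator {x : g} (hx : IsNilpotent (LieAlgebra.ad ℂ g x)) {w : V}
    (hgen : ∀ N : Submodule ℂ V, w ∈ N → (∀ x m, ∀ v ∈ N, ρ (uElt x m) v ∈ N) → N = ⊤)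
    (hw : ∃ k, (ρ (uElt x 0) ^ k) w = 0) (v : V) : ∃ k, (ρ (uElt x 0) ^ k) v = 0 := by
  let N : Submodule ℂ V := (ρ (uElt x 0)).maxGenEigenspace 0
  have hN : ∀ v, v ∈ N ↔ ∃ k, (ρ (uElt x 0) ^ k) v = 0 := fun v => by
    rw [Module.End.mem_maxGenEigenspace]; simp
  rw [← hN]
  have hup : ∀ v, ρ (uElt x 0) v ∈ N → v ∈ N := by
    intro v hv
    obtain ⟨k, hk⟩ := (hN _).1 hv
    exact (hN _).2 ⟨k + 1, by rw [pow_succ, Module.End.mul_apply, hk]⟩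
  -- Double induction. In x y_m v = y_m x v + [x,y]_m v the first term lowers the nilpotency
  -- exponent k of v, the second the exponent j of y.
  have main : ∀ (j k : ℕ) (y : g) (m : ℤ) (v : V), (LieAlgebra.ad ℂ g x ^ j) y = 0 →
      (ρ (uElt x 0) ^ k) v = 0 → ρ (uElt y m) v ∈ N := by
    intro j
    induction j with
    | zero =>
      intro k y m v hy _
      have hy' : y = 0 := by simpa using hy
      rw [hy', map_uElt_zero]
      exact N.zero_mem
    | succ j ihj =>
      intro k
      induction k with
      | zero =>
        intro y m v _ hv
        have hv' : v = 0 := by simpa using hv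
        rw [hv', map_zero]
        exact N.zero_mem
      | succ k ihk =>
        intro y m v hy hv
        apply hup
        rw [map_uElt_comm]
        refine N.add_mem (ihk y m _ hy ?_) (ihj (k + 1) _ _ v ?_ hv)
        · rwa [pow_succ, Module.End.mul_apply] at hv
        · rwa [pow_succ, Module.End.mul_apply] at hy
  have htop : N = ⊤ := by
    refine hgen N ((hN w).2 hw) fun y m v hv => ?_
    obtain ⟨j, hj⟩ := hx
    obtain ⟨k, hk⟩ := (hN v).1 hv
    exact main j k y m v (by rw [hj, LinearMap.zero_apply]) hk
  rw [htop]
  trivial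

section Weights

variable (ρ) (H : LieSubalgebra ℂ g)

/-- The weight space for the action of `H = H ⊗ 1`. -/
def loopWeightSpace (μ : Dual ℂ H) : Submodule ℂ V :=
  ⨅ h : H, (ρ (uElt (h : g) 0)).eigenspace (μ h)

variable {ρ H}

theorem mem_loopWeightSpace {μ : Dual ℂ H} {v : V} :
    v ∈ loopWeightSpace ρ H μ ↔ ∀ h : H, ρ (uElt (h : g) 0) v = μ h • v := by
  simp [loopWeightSpace, Submodule.mem_iInf]

theorem mem_loopWeightSpace_add {x : g} {α μ : Dual ℂ H} (hx : ∀ h : H, ⁅(h : g), x⁆ = α h • x)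
    (m : ℤ) {v : V} (hv : v ∈ loopWeightSpace ρ H μ) :
    ρ (uElt x m) v ∈ loopWeightSpace ρ H (α + μ) := by
  rw [mem_loopWeightSpace] at hv ⊢
  intro h
  rw [map_uElt_comm, hv h, hx h, zero_add, map_uElt_smul, map_smul, ← add_smul,
    LinearMap.add_apply, add_comm]

theorem pow_mem_loopWeightSpace {x : g} {α μ : Dual ℂ H}
    (hx : ∀ h : H, ⁅(h : g), x⁆ = α h • x) (m : ℤ) {v : V} (hv : v ∈ loopWeightSpace ρ H μ)
    (k : ℕ) : (ρ (uElt x m) ^ k) v ∈ loopWeightSpace ρ H (k • α + μ) := by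
  induction k with
  | zero => simpa using hv
  | succ k ih =>
    rw [pow_succ', Module.End.mul_apply, succ_nsmul', add_assoc]
    exact mem_loopWeightSpace_add hx m ih

theorem commute_map_uElt [IsLieAbelian H] (x y : H) (m n : ℤ) :
    Commute (ρ (uElt (x : g) m)) (ρ (uElt (y : g) n)) := by
  ext v
  have h : ⁅(x : g), (y : g)⁆ = 0 := by
    rw [← LieSubalgebra.coe_bracket, trivial_lie_zero H H x y, ZeroMemClass.coe_zero]
  rw [Module.End.mul_apply, map_uElt_comm, h, map_uElt_zero, add_zero]
  rfl

variable (ρ H) in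
theorem iSupIndep_loopWeightSpace [IsLieAbelian H] : iSupIndep (loopWeightSpace ρ H) :=
  iSupIndep_iInf_eigenspace (fun h : H => ρ (uElt (h : g) 0))
    (fun x y => commute_map_uElt x y 0 0) (fun μ : Dual ℂ H => ⇑μ) DFunLike.coe_injective

/-- If there are finitely many weights, then elements of nonzero weight act locally
nilpotently. -/
theorem locally_nilpotent_of_finite (hfin : {μ | loopWeightSpace ρ H μ ≠ ⊥}.Finite)
    (htop : ⨆ μ, loopWeightSpace ρ H μ = ⊤) {x : g} {α : Dual ℂ H} (hα : α ≠ 0)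
    (hx : ∀ h : H, ⁅(h : g), x⁆ = α h • x) (m : ℤ) (v : V) :
    ∃ k, (ρ (uElt x m) ^ k) v = 0 := by
  have hv : v ∈ ⨆ μ, loopWeightSpace ρ H μ := htop ▸ Submodule.mem_top
  induction hv using Submodule.iSup_induction' with
  | mem μ v hv =>
    -- The weights kα + μ are pairwise distinct, so one of them does not occur in V.
    have hinj : Function.Injective fun k : ℕ => k • α + μ := by
      intro a c h
      have h' : a • α = c • α := add_right_cancel h
      rw [← Nat.cast_smul_eq_nsmul ℂ, ← Nat.cast_smul_eq_nsmul ℂ] at h'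
      exact_mod_cast smul_left_injective ℂ hα h'
    have hex : ∃ k : ℕ, k • α + μ ∉ {μ | loopWeightSpace ρ H μ ≠ ⊥} := by
      by_contra! hall
      exact Set.infinite_of_injective_forall_mem hinj hall hfin
    obtain ⟨k, hk⟩ := hex
    refine ⟨k, ?_⟩
    have := pow_mem_loopWeightSpace hx m hv k
    rw [Set.mem_ofPred_eq, not_not] at hk
    rwa [hk, Submodule.mem_bot] at this
  | zero => exact ⟨0, by simp⟩
  | add v v' _ _ hv hv' =>
    obtain ⟨k, hk⟩ := hv
    obtain ⟨k', hk'⟩ := hv'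
    refine ⟨max k k', ?_⟩
    rw [map_add, Module.End.pow_map_zero_of_le (le_max_left _ _) hk,
      Module.End.pow_map_zero_of_le (le_max_right _ _) hk', add_zero]

end Weights

end Representation

/-! ### Integrable highest weight modules: their weights and root vectors -/

section HighestWeight

variable {g : Type*} [LieRing g] [LieAlgebra ℂ g] [FiniteDimensional ℂ g] [IsKilling ℂ g]
variable {H : LieSubalgebra ℂ g} [H.IsCartanSubalgebra] {b : (rootSystem H).Base}
variable {V : Type*} [AddCommGroup V] [Module ℂ V]

theorem lie_pos (X : RootVectors b) {α : H.root} (hα : b.IsPos α) (h : H) :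
    ⁅(h : g), X.pos α⁆ = (rootSystem H).root α h • X.pos α :=
  lie_eq_smul_of_mem_rootSpace (X.pos_mem α hα) h

theorem lie_neg (X : RootVectors b) {α : H.root} (hα : b.IsPos α) (h : H) :
    ⁅(h : g), X.neg α⁆ = (-(rootSystem H).root α) h • X.neg α :=
  lie_eq_smul_of_mem_rootSpace (X.neg_mem α hα) h

theorem lie_simple_pos (X : RootVectors b) (i : b.support) (h : H) :
    ⁅(h : g), X.pos i⁆ = (rootSystem H).root i h • X.pos i :=
  lie_pos X (b.isPos_of_mem_support i.2) h

theorem lie_simple_neg (X : RootVectors b) (i : b.support) (h : H) :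
    ⁅(h : g), X.neg i⁆ = (-(rootSystem H).root i) h • X.neg i :=
  lie_neg X (b.isPos_of_mem_support i.2) h

theorem eq_top_of_simple_stable (X : RootVectors b) (ρ : ULoop g →ₐ[ℂ] Module.End ℂ V) {w : V}
    (hgen : ∀ N : Submodule ℂ V, w ∈ N → (∀ x m, ∀ v ∈ N, ρ (uElt x m) v ∈ N) → N = ⊤)
    (N : Submodule ℂ V) (hw : w ∈ N) (hH : ∀ (h : H) m, ∀ v ∈ N, ρ (uElt (h : g) m) v ∈ N)
    (hp : ∀ (i : b.support) m, ∀ v ∈ N, ρ (uElt (X.pos i) m) v ∈ N)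
    (hn : ∀ (i : b.support) m, ∀ v ∈ N, ρ (uElt (X.neg i) m) v ∈ N) : N = ⊤ := by
  have h := eq_top_of_simple_mem X (loopStabilizer ρ N) hH hp hn
  refine hgen N hw fun x m v hv => ?_
  have hx : x ∈ loopStabilizer ρ N := by rw [h]; trivial
  exact hx m v hv

/-- `V` is spanned by the images of a subspace `V₀` under products of the `x⁻_{i,m}`, if `V₀`
contains a generator, is killed by the `x⁺_{i,m}` and stable under the `h ⊗ t ^ m`. -/
theorem eq_top_of_neg_stable (X : RootVectors b) (ρ : ULoop g →ₐ[ℂ] Module.End ℂ V) {w : V}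
    (hgen : ∀ N : Submodule ℂ V, w ∈ N → (∀ x m, ∀ v ∈ N, ρ (uElt x m) v ∈ N) → N = ⊤)
    (V₀ : Submodule ℂ V) (hw : w ∈ V₀)
    (hpos : ∀ (i : b.support) m, ∀ v ∈ V₀, ρ (uElt (X.pos i) m) v = 0)
    (hH : ∀ (h : H) m, ∀ v ∈ V₀, ρ (uElt (h : g) m) v ∈ V₀)
    (N : Submodule ℂ V) (hN : V₀ ≤ N)
    (hneg : ∀ (i : b.support) m, ∀ v ∈ N, ρ (uElt (X.neg i) m) v ∈ N) : N = ⊤ := by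
  set M := sInf {N : Submodule ℂ V | V₀ ≤ N ∧
    ∀ (i : b.support) m, ∀ v ∈ N, ρ (uElt (X.neg i) m) v ∈ N}
  have hM0 : V₀ ≤ M := le_sInf fun N hN => hN.1
  have hMneg : ∀ (i : b.support) m, ∀ v ∈ M, ρ (uElt (X.neg i) m) v ∈ M := by
    intro i m v hv
    rw [Submodule.mem_sInf] at hv ⊢
    exact fun N hN => hN.2 i m v (hv N hN)
  -- M' consists of the vectors of M sent into M by all x⁺_{i,m} and h_m. By the commutation
  -- relations it satisfies the conditions defining the smallest subspace M, so M ≤ M', and M is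
  -- stable under all generators.
  let M' : Submodule ℂ V :=
    { carrier := {v | v ∈ M ∧ (∀ (i : b.support) m, ρ (uElt (X.pos i) m) v ∈ M) ∧
        ∀ (h : H) m, ρ (uElt (h : g) m) v ∈ M}
      add_mem' := fun {u v} hu hv => ⟨M.add_mem hu.1 hv.1,
        fun i m => by rw [map_add]; exact M.add_mem (hu.2.1 i m) (hv.2.1 i m),
        fun h m => by rw [map_add]; exact M.add_mem (hu.2.2 h m) (hv.2.2 h m)⟩
      zero_mem' := ⟨M.zero_mem, fun i m => by rw [map_zero]; exact M.zero_mem,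
        fun h m => by rw [map_zero]; exact M.zero_mem⟩
      smul_mem' := fun c v hv => ⟨M.smul_mem c hv.1,
        fun i m => by rw [map_smul]; exact M.smul_mem c (hv.2.1 i m),
        fun h m => by rw [map_smul]; exact M.smul_mem c (hv.2.2 h m)⟩ }
  have hMM' : M ≤ M' := by
    refine sInf_le ⟨fun v hv => ⟨hM0 hv, fun i m => ?_, fun h m => hM0 (hH h m v hv)⟩, ?_⟩
    · rw [hpos i m v hv]; exact M.zero_mem
    · rintro j n v ⟨hv, hvp, hvH⟩
      refine ⟨hMneg j n v hv, fun i m => ?_, fun h m => ?_⟩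
      · rw [map_uElt_comm]
        refine M.add_mem (hMneg j n _ (hvp i m)) ?_
        by_cases hij : i = j
        · subst hij
          rw [(X.sl2 i (b.isPos_of_mem_support i.2)).lie_e_f]
          exact hvH _ _
        · rw [lie_pos_neg_of_ne X hij, map_uElt_zero]
          exact M.zero_mem
      · rw [map_uElt_comm, lie_simple_neg, map_uElt_smul]
        exact M.add_mem (hMneg j n _ (hvH h m)) (M.smul_mem _ (hMneg j _ v hv))
  have hM : M = ⊤ := eq_top_of_simple_stable X ρ hgen M (hM0 hw)
    (fun h m v hv => (hMM' hv).2.2 h m) (fun i m v hv => (hMM' hv).2.1 i m) hMneg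
  rw [eq_top_iff, ← hM]
  exact sInf_le ⟨hN, hneg⟩

/-- `V` is an `L(g)`-module generated by a vector `w` of integral weight `lam`, which is killed by
the `x⁺_{i,m}` and on which the `x⁻_{i,0}` are nilpotent. -/
structure IsIntegrableHighestWeight (ρ : ULoop g →ₐ[ℂ] Module.End ℂ V) (X : RootVectors b)
    (lam : Dual ℂ H) (w : V) : Prop where
  gen : ∀ N : Submodule ℂ V, w ∈ N → (∀ x m, ∀ v ∈ N, ρ (uElt x m) v ∈ N) → N = ⊤
  pos : ∀ (i : b.support) m, ρ (uElt (X.pos i) m) w = 0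
  cartan : ∀ h : H, ρ (uElt (h : g) 0) w = lam h • w
  neg : ∀ i : b.support, ∃ k, (ρ (uElt (X.neg i) 0) ^ k) w = 0
  int : ∀ i : b.support, ∃ n : ℤ, lam ((rootSystem H).coroot i) = n

namespace IsIntegrableHighestWeight

variable {ρ : ULoop g →ₐ[ℂ] Module.End ℂ V} {X : RootVectors b} {lam : Dual ℂ H} {w : V}

theorem iSup_weight_le_eq_top (hw : IsIntegrableHighestWeight ρ X lam w) :
    ⨆ μ ∈ {μ | lam - μ ∈ AddSubmonoid.closure ((rootSystem H).root '' b.support)},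
      loopWeightSpace ρ H μ = ⊤ := by
  -- The line through w need not be stable under h ⊗ t^m; the space of all vectors of weight `lam`
  -- killed by the x⁺_{i,m} is.
  let V₀ : Submodule ℂ V := loopWeightSpace ρ H lam ⊓
    ⨅ (i : b.support) (m : ℤ), LinearMap.ker (ρ (uElt (X.pos i) m))
  have hV₀ : ∀ v, v ∈ V₀ ↔ v ∈ loopWeightSpace ρ H lam ∧
      ∀ (i : b.support) m, ρ (uElt (X.pos i) m) v = 0 := by
    intro v
    simp [V₀, Submodule.mem_iInf]
  refine eq_top_of_neg_stable X ρ hw.gen V₀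
    ((hV₀ w).2 ⟨mem_loopWeightSpace.2 hw.cartan, hw.pos⟩) (fun i m v hv => ((hV₀ v).1 hv).2 i m)
    (fun h m v hv => ?_) _ (fun v hv => ?_) (fun i m v hv => ?_)
  · obtain ⟨h1, h2⟩ := (hV₀ v).1 hv
    refine (hV₀ _).2 ⟨?_, fun i n => ?_⟩
    · rw [mem_loopWeightSpace] at h1 ⊢
      intro h'
      rw [← Module.End.mul_apply, commute_map_uElt h' h 0 m, Module.End.mul_apply, h1 h', map_smul]
    · have := map_uElt_comm ρ (h : g) (X.pos i) m n v
      rw [h2 i n, map_zero, lie_simple_pos, map_uElt_smul, h2 i (m + n), smul_zero, add_zero] at this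
      exact this.symm
  · refine Submodule.mem_iSup_of_mem lam (Submodule.mem_iSup_of_mem ?_ ((hV₀ v).1 hv).1)
    rw [Set.mem_ofPred_eq, sub_self]
    exact AddSubmonoid.zero_mem _
  · induction hv using Submodule.iSup_induction' with
    | mem μ v hv =>
      induction hv using Submodule.iSup_induction' with
      | mem hμ v hv =>
        refine Submodule.mem_iSup_of_mem (-(rootSystem H).root i + μ)
          (Submodule.mem_iSup_of_mem ?_ (mem_loopWeightSpace_add (lie_simple_neg X i) m hv))
        have : lam - (-(rootSystem H).root i + μ) = (rootSystem H).root i + (lam - μ) := by abel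
        rw [Set.mem_ofPred_eq, this]
        exact AddSubmonoid.add_mem _ (AddSubmonoid.subset_closure ⟨i, i.2, rfl⟩) hμ
      | zero => rw [map_zero]; exact Submodule.zero_mem _
      | add u v _ _ hu hv => rw [map_add]; exact Submodule.add_mem _ hu hv
    | zero => rw [map_zero]; exact Submodule.zero_mem _
    | add u v _ _ hu hv => rw [map_add]; exact Submodule.add_mem _ hu hv

theorem iSup_weight_eq_top (hw : IsIntegrableHighestWeight ρ X lam w) :
    ⨆ μ, loopWeightSpace ρ H μ = ⊤ :=
  eq_top_iff.2 (hw.iSup_weight_le_eq_top ▸ iSup_mono fun _ => iSup_le fun _ => le_rfl)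

/-- Weight spaces are independent and those below `lam` already span V, so no other weight occurs.
-/
theorem sub_mem_closure (hw : IsIntegrableHighestWeight ρ X lam w) {μ : Dual ℂ H}
    (hμ : loopWeightSpace ρ H μ ≠ ⊥) :
    lam - μ ∈ AddSubmonoid.closure ((rootSystem H).root '' b.support) :=
  (iSupIndep_loopWeightSpace ρ H).mem_of_biSup_eq_top hw.iSup_weight_le_eq_top hμ

theorem exists_pos_pow_eq_zero (hw : IsIntegrableHighestWeight ρ X lam w) (i : b.support) (v : V) :
    ∃ k, (ρ (uElt (X.pos i) 0) ^ k) v = 0 := by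
  have hi := b.isPos_of_mem_support i.2
  refine locally_nilpotent_of_generator ?_ hw.gen ⟨1, ?_⟩ v
  · exact LieAlgebra.isNilpotent_ad_of_mem_rootSpace H
      (fun h => H.isNonZero_coe_root i h) (X.pos_mem i hi)
  · rw [pow_one, hw.pos]

theorem exists_neg_pow_eq_zero (hw : IsIntegrableHighestWeight ρ X lam w) (i : b.support) (v : V) :
    ∃ k, (ρ (uElt (X.neg i) 0) ^ k) v = 0 := by
  have hi := b.isPos_of_mem_support i.2
  refine locally_nilpotent_of_generator ?_ hw.gen (hw.neg i) v
  exact LieAlgebra.isNilpotent_ad_of_mem_rootSpace H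
      (fun h => H.isNonZero_coe_root i (neg_eq_zero.1 h)) (X.neg_mem i hi)

/-- Let n = μ(h_i), an integer, and v a vector of weight μ. If n ≥ 0, some f^(p+n) e^p v is a
nonzero vector of weight μ − nα_i. If n < 0, the roles of e and f are exchanged. -/
theorem reflection_weight (hw : IsIntegrableHighestWeight ρ X lam w) {μ : Dual ℂ H}
    (hμ : loopWeightSpace ρ H μ ≠ ⊥) (i : b.support) :
    loopWeightSpace ρ H ((rootSystem H).reflection i μ) ≠ ⊥ := by
  let _ : LieRingModule g V := LieRingModule.compLieHom V (constHom ρ)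
  have : LieModule ℂ g V := LieModule.compLieHom V (constHom ρ)
  have htoEnd : ∀ x : g, LieModule.toEnd ℂ g V x = ρ (uElt x 0) := fun x => rfl
  have hi := b.isPos_of_mem_support i.2
  have hint : ∃ z : ℤ, μ ((rootSystem H).coroot i) = z := by
    have : ∀ q ∈ AddSubmonoid.closure ((rootSystem H).root '' b.support),
        ∃ z : ℤ, q ((rootSystem H).coroot i) = z := by
      intro q hq
      induction hq using AddSubmonoid.closure_induction with
      | mem q hq =>
        obtain ⟨j, -, rfl⟩ := hq
        exact ⟨_, apply_coroot_eq_cast _ _⟩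
      | zero => exact ⟨0, by simp⟩
      | add x y _ _ hx hy =>
        obtain ⟨k, hk⟩ := hx
        obtain ⟨l, hl⟩ := hy
        exact ⟨k + l, by rw [LinearMap.add_apply, hk, hl]; push_cast; rfl⟩
    obtain ⟨k, hk⟩ := this _ (hw.sub_mem_closure hμ)
    obtain ⟨n, hn⟩ := hw.int i
    refine ⟨n - k, ?_⟩
    rw [LinearMap.sub_apply, hn] at hk
    push_cast
    rw [← hk]
    ring
  obtain ⟨v, hv, hv0⟩ := Submodule.exists_mem_ne_zero_of_ne_bot hμ
  have hrefl : (rootSystem H).reflection i μ =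
      μ - μ ((rootSystem H).coroot i) • (rootSystem H).root i := by
    rw [RootPairing.reflection_apply]
    rfl
  have t := X.sl2 i hi
  obtain ⟨z, hz⟩ := hint
  rw [Submodule.ne_bot_iff]
  rcases Int.eq_nat_or_neg z with ⟨n, rfl | rfl⟩
  · obtain ⟨p, hp⟩ := exists_pow_toEnd_ne_zero t hv0 n
      (by
        have := mem_loopWeightSpace.1 hv ((rootSystem H).coroot i)
        rw [hz] at this
        simpa using! this) (hw.exists_pos_pow_eq_zero i v)
    refine ⟨_, ?_, hp⟩
    rw [htoEnd, htoEnd]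
    convert! pow_mem_loopWeightSpace (lie_simple_neg X i) 0
      (pow_mem_loopWeightSpace (lie_simple_pos X i) 0 hv p) (p + n) using 2
    rw [hrefl, hz]
    ext x
    simp only [LinearMap.sub_apply, LinearMap.smul_apply, LinearMap.add_apply, LinearMap.neg_apply,
      smul_eq_mul, nsmul_eq_mul]
    push_cast
    ring
  · obtain ⟨p, hp⟩ := exists_pow_toEnd_ne_zero t.symm hv0 n
      (by
        have := mem_loopWeightSpace.1 hv ((rootSystem H).coroot i)
        rw [hz] at this
        rw [neg_lie, neg_eq_iff_eq_neg, ← neg_smul]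
        simpa using! this) (hw.exists_neg_pow_eq_zero i v)
    refine ⟨_, ?_, hp⟩
    rw [htoEnd, htoEnd]
    convert! pow_mem_loopWeightSpace (lie_simple_pos X i) 0
      (pow_mem_loopWeightSpace (lie_simple_neg X i) 0 hv p) (p + n) using 2
    rw [hrefl, hz]
    ext x
    simp only [LinearMap.sub_apply, LinearMap.smul_apply, LinearMap.add_apply, LinearMap.neg_apply,
      smul_eq_mul, nsmul_eq_mul]
    push_cast
    ring

theorem finite_weights (hw : IsIntegrableHighestWeight ρ X lam w) :
    {μ | loopWeightSpace ρ H μ ≠ ⊥}.Finite :=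
  finite_of_reflection_stable b lam _ (fun _ hμ => hw.sub_mem_closure hμ)
    fun i hi _ hμ => hw.reflection_weight hμ ⟨i, hi⟩

theorem exists_pow_pos_eq_zero (hw : IsIntegrableHighestWeight ρ X lam w) {α : H.root}
    (hα : b.IsPos α) (m : ℤ) (v : V) : ∃ k, (ρ (uElt (X.pos α) m) ^ k) v = 0 :=
  locally_nilpotent_of_finite hw.finite_weights hw.iSup_weight_eq_top
    ((rootSystem H).ne_zero α) (lie_pos X hα) m v

theorem exists_pow_neg_eq_zero (hw : IsIntegrableHighestWeight ρ X lam w) {α : H.root}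
    (hα : b.IsPos α) (m : ℤ) (v : V) : ∃ k, (ρ (uElt (X.neg α) m) ^ k) v = 0 :=
  locally_nilpotent_of_finite hw.finite_weights hw.iSup_weight_eq_top
    (neg_ne_zero.2 ((rootSystem H).ne_zero α)) (lie_neg X hα) m v

end IsIntegrableHighestWeight

end HighestWeight

/-! ### Two-sided linear recurrences -/

section LinearRecurrence

/-- The extreme coefficients of the recurrence are invertible, so it can be solved in both
directions. A window of length d − a, the width of the support, determines the whole sequence. -/
theorem span_range_finiteDimensional_of_recurrence {E : Type*} [AddCommGroup E] [Module ℂ E]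
    (s : ℤ → E) (c : ℤ → ℂ) (F : Finset ℤ) (hF : F.Nonempty) (hc : ∀ j ∈ F, c j ≠ 0)
    (h : ∀ m, ∑ j ∈ F, c j • s (m + j) = 0) :
    FiniteDimensional ℂ (Submodule.span ℂ (Set.range s)) := by
  set a := F.min' hF
  set d := F.max' hF
  set S : Submodule ℂ E := Submodule.span ℂ (s '' Set.Ico 0 (d - a))
  have hS : FiniteDimensional ℂ S :=
    FiniteDimensional.span_of_finite ℂ ((Set.finite_Ico _ _).image s)
  have solve : ∀ k ∈ F, ∀ m, (∀ j ∈ F, j ≠ k → s (m + j) ∈ S) → s (m + k) ∈ S := by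
    intro k hk m hm
    have hsum := h m
    rw [← Finset.add_sum_erase _ _ hk, add_eq_zero_iff_eq_neg] at hsum
    have : s (m + k) = (c k)⁻¹ • -∑ j ∈ F.erase k, c j • s (m + j) := by
      rw [← hsum, smul_smul, inv_mul_cancel₀ (hc k hk), one_smul]
    rw [this]
    refine S.smul_mem _ (S.neg_mem (S.sum_mem fun j hj => S.smul_mem _ ?_))
    exact hm j (Finset.mem_of_mem_erase hj) (Finset.ne_of_mem_erase hj)
  have hmin : ∀ j ∈ F, a ≤ j := fun j hj => F.min'_le j hj
  have hmax : ∀ j ∈ F, j ≤ d := fun j hj => F.le_max' j hj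
  have window : ∀ N : ℤ, ∀ j, N ≤ j → j < N + (d - a) → s j ∈ S := by
    intro N
    induction N using Int.induction_on with
    | zero => exact fun j h0 h1 => Submodule.subset_span ⟨j, ⟨h0, by linarith⟩, rfl⟩
    | succ N ih =>
      intro j h0 h1
      rcases lt_or_ge j (N + (d - a)) with hj | hj
      · exact ih j (by omega) hj
      · have := solve d (F.max'_mem hF) (j - d) fun l hl hld => ih _
          (by have := hmin l hl; omega) (by have := hmax l hl; omega)
        rwa [sub_add_cancel] at this
    | pred N ih =>
      intro j h0 h1
      rcases lt_or_ge j (-(N : ℤ)) with hj | hj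
      · have := solve a (F.min'_mem hF) (j - a) fun l hl hla => ih _
          (by have := hmin l hl; omega) (by have := hmax l hl; omega)
        rwa [sub_add_cancel] at this
      · exact ih j hj (by omega)
  have had : a ≤ d := hmin d (F.max'_mem hF)
  refine Submodule.finiteDimensional_of_le (S₂ := S) (Submodule.span_le.2 ?_)
  rintro _ ⟨j, rfl⟩
  -- If the support is a single point, the window is empty and cannot contain j; the one-term
  -- recurrence then applies directly.
  rcases had.eq_or_lt with had' | had'
  · have := solve d (F.max'_mem hF) (j - d) fun l hl hld =>
      absurd (le_antisymm (hmax l hl) (had' ▸ hmin l hl)) hld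
    rwa [sub_add_cancel] at this
  · exact window j j le_rfl (by omega)

theorem finiteDimensional_of_mul_eq_zero {E : Type*} [AddCommGroup E] [Module ℂ E]
    (T : AddMonoidAlgebra ℂ ℤ →ₗ[ℂ] E) {p : AddMonoidAlgebra ℂ ℤ} (hp : p ≠ 0)
    (h : ∀ q, T (q * p) = 0) :
    FiniteDimensional ℂ (Submodule.span ℂ (Set.range fun m => T (AddMonoidAlgebra.single m 1))) := by
  refine span_range_finiteDimensional_of_recurrence _ p.coeff p.coeff.support
    (Finsupp.support_nonempty_iff.2 (by simpa using hp))
    (fun j hj => Finsupp.mem_support_iff.1 hj) fun m => ?_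
  rw [← h (AddMonoidAlgebra.single m 1)]
  conv_rhs => rw [← AddMonoidAlgebra.sum_coeff_single p]
  rw [Finsupp.sum, Finset.mul_sum, map_sum]
  refine Finset.sum_congr rfl fun j _ => ?_
  rw [AddMonoidAlgebra.single_mul_single, ← map_smul, AddMonoidAlgebra.smul_single, smul_eq_mul,
    mul_one, one_mul]

end LinearRecurrence

/-! ### Annihilating Laurent polynomials -/

section PolynomialCoefficients

variable {g : Type*} [LieRing g] [LieAlgebra ℂ g]
variable {V : Type*} [AddCommGroup V] [Module ℂ V] (ρ : ULoop g →ₐ[ℂ] Module.End ℂ V)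

/-- The action of `p ⊗ x` for a Laurent polynomial `p`, as a bilinear map. -/
def laurentAction : g →ₗ[ℂ] AddMonoidAlgebra ℂ ℤ →ₗ[ℂ] Module.End ℂ V :=
  ((TensorProduct.mk ℂ (AddMonoidAlgebra ℂ ℤ) g).compr₂
    (ρ.toLinearMap ∘ₗ (UniversalEnvelopingAlgebra.ι ℂ : Loop g →ₗ⁅ℂ⁆ ULoop g).toLinearMap)).flip

theorem laurentAction_apply (x : g) (p : AddMonoidAlgebra ℂ ℤ) :
    laurentAction ρ x p = ρ (UniversalEnvelopingAlgebra.ι ℂ ((p ⊗ₜ[ℂ] x : Loop g))) := rfl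

theorem laurentAction_single (x : g) (m : ℤ) :
    laurentAction ρ x (AddMonoidAlgebra.single m 1) = ρ (uElt x m) := rfl

theorem laurentAction_comm (x y : g) (p q : AddMonoidAlgebra ℂ ℤ) (v : V) :
    laurentAction ρ x p (laurentAction ρ y q v) =
      laurentAction ρ y q (laurentAction ρ x p v) + laurentAction ρ ⁅x, y⁆ (p * q) v := by
  have h1 : ⁅(p ⊗ₜ[ℂ] x : Loop g), (q ⊗ₜ[ℂ] y : Loop g)⁆ = ((p * q) ⊗ₜ[ℂ] ⁅x, y⁆ : Loop g) :=
    LieAlgebra.ExtendScalars.bracket_tmul ..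
  have h2 : UniversalEnvelopingAlgebra.ι ℂ ⁅(p ⊗ₜ[ℂ] x : Loop g), (q ⊗ₜ[ℂ] y : Loop g)⁆ =
      UniversalEnvelopingAlgebra.ι ℂ (p ⊗ₜ[ℂ] x : Loop g) *
        UniversalEnvelopingAlgebra.ι ℂ (q ⊗ₜ[ℂ] y : Loop g) -
      UniversalEnvelopingAlgebra.ι ℂ (q ⊗ₜ[ℂ] y : Loop g) *
        UniversalEnvelopingAlgebra.ι ℂ (p ⊗ₜ[ℂ] x : Loop g) :=
    LieHom.map_lie (UniversalEnvelopingAlgebra.ι ℂ) _ _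
  simp only [laurentAction_apply]
  rw [← h1, h2, map_sub, map_mul, map_mul, LinearMap.sub_apply, Module.End.mul_apply,
    Module.End.mul_apply, add_sub_cancel]

-- The recurrence says that p = ∑ c_j t^(−j) and all its shifts, tensored with x, kill w. The
-- coefficient of p at t^0 is c 0 = 1, so p ≠ 0.
variable {ρ} in
theorem exists_laurentAction_eq_zero_of_sum (x : g) (w : V) (c : ℕ → ℂ) (k : ℕ) (hc : c 0 = 1)
    (h : ∀ m : ℤ, ∑ j ∈ Finset.range (k + 1), c j • ρ (uElt x (m - j)) w = 0) :
    ∃ p : AddMonoidAlgebra ℂ ℤ, p ≠ 0 ∧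
      ∀ m, laurentAction ρ x (AddMonoidAlgebra.single m 1 * p) w = 0 := by
  refine ⟨∑ j ∈ Finset.range (k + 1), AddMonoidAlgebra.single (-(j : ℤ)) (c j), fun h0 => ?_,
    fun m => ?_⟩
  · have h1 := congrArg (fun p : AddMonoidAlgebra ℂ ℤ => p.coeff 0) h0
    simp only [AddMonoidAlgebra.coeff_sum, Finsupp.finsetSum_apply, AddMonoidAlgebra.coeff_single,
      AddMonoidAlgebra.coeff_zero, Finsupp.zero_apply] at h1
    rw [Finset.sum_eq_single 0 (fun j _ hj => Finsupp.single_eq_of_ne (by simpa using hj))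
      (by simp), Nat.cast_zero, neg_zero, Finsupp.single_eq_same, hc] at h1
    exact one_ne_zero h1
  · rw [Finset.mul_sum, map_sum, LinearMap.sum_apply, ← h m]
    refine Finset.sum_congr rfl fun j _ => ?_
    have h1 : AddMonoidAlgebra.single m 1 * AddMonoidAlgebra.single (-(j : ℤ)) (c j) =
        c j • (AddMonoidAlgebra.single (m - j) 1 : AddMonoidAlgebra ℂ ℤ) := by
      rw [AddMonoidAlgebra.smul_single, smul_eq_mul, mul_one, AddMonoidAlgebra.single_mul_single,
        one_mul, sub_eq_add_neg]
    rw [h1, map_smul, LinearMap.smul_apply, laurentAction_single]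

variable {ρ} in
theorem sum_smul_eq_zero_of_sum_mul (x : g) (w : V) (Λ : ℕ → ULoop g) (c : ℕ → ℂ)
    (hΛ : ∀ j, ρ (Λ j) w = c j • w) (k : ℕ) (m : ℤ)
    (h : ρ ((∑ j ∈ Finset.range (k + 1), uElt x (m + 1 - j - 1) * Λ j) * 1) w = 0) :
    ∑ j ∈ Finset.range (k + 1), c j • ρ (uElt x (m - j)) w = 0 := by
  rw [mul_one, map_sum, LinearMap.sum_apply] at h
  refine (Finset.sum_congr rfl fun j _ => ?_).trans h
  rw [map_mul, Module.End.mul_apply, hΛ, LinearMap.map_smul,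
    show m + 1 - (j : ℤ) - 1 = m - j by ring]

/-- The `x` such that `q p ⊗ x` kills `w` for some nonzero `p` and all `q`. -/
def torsionSubalgebra (w : V) : LieSubalgebra ℂ g where
  carrier := {x | ∃ p : AddMonoidAlgebra ℂ ℤ, p ≠ 0 ∧ ∀ q, laurentAction ρ x (q * p) w = 0}
  add_mem' := by
    rintro x y ⟨p, hp, hpx⟩ ⟨q, hq, hqy⟩
    refine ⟨p * q, mul_ne_zero hp hq, fun r => ?_⟩
    rw [map_add, LinearMap.add_apply, LinearMap.add_apply, ← mul_assoc, hqy, mul_right_comm, hpx,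
      add_zero]
  zero_mem' := ⟨1, one_ne_zero, fun q => by simp⟩
  smul_mem' := by
    rintro c x ⟨p, hp, hpx⟩
    exact ⟨p, hp, fun q => by
      rw [map_smul, LinearMap.smul_apply, LinearMap.smul_apply, hpx, smul_zero]⟩
  lie_mem' := by
    rintro x y ⟨p, hp, hpx⟩ ⟨q, hq, hqy⟩
    -- The element r p q ⊗ [x, y] is the commutator of r p ⊗ x and q ⊗ y, both of which kill w.
    refine ⟨p * q, mul_ne_zero hp hq, fun r => ?_⟩
    have h := laurentAction_comm ρ x y (r * p) q w
    have h1 := hqy 1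
    have h2 := hpx r
    rw [one_mul] at h1
    rw [h1, h2, map_zero, map_zero, zero_add, mul_assoc] at h
    exact h.symm

variable {ρ}

/-- If `V` is generated by `w` and all of `g` is torsion at `w`, then a nonzero ideal
`p ℂ[t, t⁻¹] ⊗ g` acts trivially on `V`. -/
theorem exists_laurentAction_eq_zero [FiniteDimensional ℂ g] {w : V}
    (hgen : ∀ N : Submodule ℂ V, w ∈ N → (∀ x m, ∀ v ∈ N, ρ (uElt x m) v ∈ N) → N = ⊤)
    (htop : torsionSubalgebra ρ w = ⊤) :
    ∃ p : AddMonoidAlgebra ℂ ℤ, p ≠ 0 ∧ ∀ x q, laurentAction ρ x (q * p) = 0 := by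
  have hall : ∀ x : g, ∃ p : AddMonoidAlgebra ℂ ℤ, p ≠ 0 ∧
      ∀ q, laurentAction ρ x (q * p) w = 0 := fun x => by
    have : x ∈ torsionSubalgebra ρ w := by rw [htop]; trivial
    exact this
  choose P hP0 hP using hall
  let B := Module.finBasis ℂ g
  set p := ∏ i, P (B i)
  have hw : ∀ x q, laurentAction ρ x (q * p) w = 0 := by
    intro x q
    have hx : x ∈ Submodule.span ℂ (Set.range B) := by rw [B.span_eq]; trivial
    induction hx using Submodule.span_induction with
    | mem x hx =>
      obtain ⟨i, rfl⟩ := hx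
      have : q * p = q * (∏ j ∈ Finset.univ.erase i, P (B j)) * P (B i) := by
        rw [mul_assoc, Finset.prod_erase_mul _ _ (Finset.mem_univ i)]
      rw [this, hP]
    | zero => simp
    | add x y _ _ hx hy => rw [map_add, LinearMap.add_apply, LinearMap.add_apply, hx, hy, add_zero]
    | smul c x _ hx => rw [map_smul, LinearMap.smul_apply, LinearMap.smul_apply, hx, smul_zero]
  refine ⟨p, Finset.prod_ne_zero_iff.2 fun i _ => hP0 _, fun x q => ?_⟩
  -- The common kernel of p ℂ[t, t⁻¹] ⊗ g is stable under L(g), because commutators with this ideal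
  -- stay in it, and it contains the generator.
  let N : Submodule ℂ V := ⨅ (x : g) (q : AddMonoidAlgebra ℂ ℤ),
    LinearMap.ker (laurentAction ρ x (q * p))
  have hN : ∀ v, v ∈ N ↔ ∀ x q, laurentAction ρ x (q * p) v = 0 := fun v => by
    simp [N, Submodule.mem_iInf]
  have hNtop : N = ⊤ := by
    refine hgen N ((hN w).2 hw) fun y m v hv => (hN _).2 fun x q => ?_
    have hv' := (hN v).1 hv
    rw [← laurentAction_single, laurentAction_comm, hv', map_zero, mul_right_comm, hv', zero_add]
  ext v
  exact (hN v).1 (hNtop ▸ Submodule.mem_top) x q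

end PolynomialCoefficients

/-! ### Finite-dimensionality criterion -/

section FiniteDimension

variable {g : Type*} [LieRing g] [LieAlgebra ℂ g] [FiniteDimensional ℂ g] [IsKilling ℂ g]
variable {H : LieSubalgebra ℂ g} [H.IsCartanSubalgebra] {b : (rootSystem H).Base}
variable {V : Type*} [AddCommGroup V] [Module ℂ V]
variable {ρ : ULoop g →ₐ[ℂ] Module.End ℂ V} {X : RootVectors b} {lam : Dual ℂ H} {w : V}

/-- The x_i^± are torsion at w, hence so are their brackets h_i, which span H; these generate g. -/
theorem IsIntegrableHighestWeight.torsionSubalgebra_eq_top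
    (hw : IsIntegrableHighestWeight ρ X lam w)
    (hneg : ∀ i : b.support, ∃ p : AddMonoidAlgebra ℂ ℤ, p ≠ 0 ∧
      ∀ m, laurentAction ρ (X.neg i) (AddMonoidAlgebra.single m 1 * p) w = 0) :
    torsionSubalgebra ρ w = ⊤ := by
  have ext_single : ∀ (x : g) (p : AddMonoidAlgebra ℂ ℤ),
      (∀ m, laurentAction ρ x (AddMonoidAlgebra.single m 1 * p) w = 0) →
      ∀ q, laurentAction ρ x (q * p) w = 0 := by
    intro x p h q
    induction q using AddMonoidAlgebra.induction_linear with
    | zero => rw [zero_mul, map_zero, LinearMap.zero_apply]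
    | add a a' h h' => rw [add_mul, map_add, LinearMap.add_apply, h, h', add_zero]
    | single m c =>
      have : (AddMonoidAlgebra.single m c : AddMonoidAlgebra ℂ ℤ) =
          c • AddMonoidAlgebra.single m 1 := by
        rw [AddMonoidAlgebra.smul_single, smul_eq_mul, mul_one]
      rw [this, smul_mul_assoc, map_smul, LinearMap.smul_apply, h, smul_zero]
  have hp : ∀ i : b.support, X.pos i ∈ torsionSubalgebra ρ w := fun i =>
    ⟨1, one_ne_zero, ext_single _ _ fun m => by
      rw [mul_one, laurentAction_single, hw.pos]⟩
  have hn : ∀ i : b.support, X.neg i ∈ torsionSubalgebra ρ w := fun i => by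
    obtain ⟨p, hp0, hp⟩ := hneg i
    exact ⟨p, hp0, ext_single _ _ hp⟩
  refine eq_top_of_simple_mem X _ (fun h => ?_) hp hn
  have hh : h ∈ Submodule.span ℂ (Set.range b.toCoweightBasis) := by
    rw [b.toCoweightBasis.span_eq]; trivial
  induction hh using Submodule.span_induction with
  | mem x hx =>
    obtain ⟨i, rfl⟩ := hx
    rw [b.toCoweightBasis_apply, ← (X.sl2 i (b.isPos_of_mem_support i.2)).lie_e_f]
    exact LieSubalgebra.lie_mem _ (hp i) (hn i)
  | zero => exact LieSubalgebra.zero_mem _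
  | add x y _ _ hx hy => exact LieSubalgebra.add_mem _ hx hy
  | smul c x _ hx => exact LieSubalgebra.smul_mem _ c hx

/-- The annihilator p makes the span F of the operators x⁻_{i,m} finite-dimensional. As ℂw is stable
under all h ⊗ t^m, V is the sum of the F^r w, and finiteness of the set of weights leaves only
finitely many nonzero r. -/
theorem IsIntegrableHighestWeight.finiteDimensional
    (hw : IsIntegrableHighestWeight ρ X lam w)
    (hH : ∀ (h : H) m, ρ (uElt (h : g) m) w ∈ Submodule.span ℂ {w})
    (hneg : ∀ i : b.support, ∃ p : AddMonoidAlgebra ℂ ℤ, p ≠ 0 ∧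
      ∀ m, laurentAction ρ (X.neg i) (AddMonoidAlgebra.single m 1 * p) w = 0) :
    FiniteDimensional ℂ V := by
  obtain ⟨p, hp0, hp⟩ := exists_laurentAction_eq_zero hw.gen (hw.torsionSubalgebra_eq_top hneg)
  let F : Submodule ℂ (Module.End ℂ V) :=
    ⨆ i : b.support, Submodule.span ℂ (Set.range fun m : ℤ => ρ (uElt (X.neg i) m))
  have hF : FiniteDimensional ℂ F := by
    have : ∀ i : b.support, FiniteDimensional ℂ
        (Submodule.span ℂ (Set.range fun m : ℤ => ρ (uElt (X.neg i) m))) := fun i =>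
      finiteDimensional_of_mul_eq_zero (laurentAction ρ (X.neg i)) hp0 (hp _)
    exact Submodule.finiteDimensional_iSup _
  let E : ℕ → Submodule ℂ V := fun r =>
    Nat.rec (Submodule.span ℂ {w}) (fun _ S => Submodule.map₂ LinearMap.id F S) r
  have hE0 : E 0 = Submodule.span ℂ {w} := rfl
  have hEs : ∀ r, E (r + 1) = Submodule.map₂ LinearMap.id F (E r) := fun r => rfl
  have hEfin : ∀ r, (E r).FG := by
    intro r
    induction r with
    | zero => exact Submodule.fg_span_singleton w
    | succ r ih => exact Submodule.FG.map₂ _ (Module.Finite.iff_fg.1 hF) ih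
  -- The height, equal to 1 on each simple root: each factor from F raises the height of `lam` − μ
  -- by one.
  let ht : Dual ℂ H →ₗ[ℂ] ℂ := b.toWeightBasis.constr ℂ fun _ => 1
  have hht : ∀ i : b.support, ht ((rootSystem H).root i) = 1 := fun i => by
    rw [← b.toWeightBasis_apply, Basis.constr_basis]
  have hEwt : ∀ r : ℕ, E r ≤ ⨆ μ ∈ {μ | ht (lam - μ) = r}, loopWeightSpace ρ H μ := by
    intro r
    induction r with
    | zero =>
      rw [hE0, Submodule.span_singleton_le_iff_mem]
      exact Submodule.mem_iSup_of_mem lam (Submodule.mem_iSup_of_mem (by simp)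
        (mem_loopWeightSpace.2 hw.cartan))
    | succ r ih =>
      rw [hEs, Submodule.map₂_le]
      intro T hT v hv
      replace hv := ih hv
      clear ih
      induction hT using Submodule.iSup_induction' with
      | zero => exact Submodule.zero_mem _
      | add S T _ _ hS hT => exact Submodule.add_mem _ hS hT
      | mem i T hT =>
        induction hT using Submodule.span_induction with
        | zero => exact Submodule.zero_mem _
        | add S T _ _ hS hT => exact Submodule.add_mem _ hS hT
        | smul c T _ hT => exact Submodule.smul_mem _ c hT
        | mem T hT =>
          obtain ⟨m, rfl⟩ := hT
          change ρ (uElt (X.neg i) m) v ∈ _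
          induction hv using Submodule.iSup_induction' with
          | zero => rw [map_zero]; exact Submodule.zero_mem _
          | add u v _ _ hu hv => rw [map_add]; exact Submodule.add_mem _ hu hv
          | mem μ v hv =>
            induction hv using Submodule.iSup_induction' with
            | zero => rw [map_zero]; exact Submodule.zero_mem _
            | add u v _ _ hu hv => rw [map_add]; exact Submodule.add_mem _ hu hv
            | mem hμ v hv =>
              refine Submodule.mem_iSup_of_mem (-(rootSystem H).root i + μ)
                (Submodule.mem_iSup_of_mem ?_ (mem_loopWeightSpace_add (lie_simple_neg X i) m hv))
              have : lam - (-(rootSystem H).root i + μ) = (rootSystem H).root i + (lam - μ) := by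
                abel
              rw [Set.mem_ofPred_eq] at hμ ⊢
              rw [this, map_add, hht, hμ]
              push_cast
              ring
  obtain ⟨R, hR⟩ : ∃ R : ℕ, ∀ r ≥ R, E r = ⊥ := by
    have hfin : {r : ℕ | ∃ μ, loopWeightSpace ρ H μ ≠ ⊥ ∧ ht (lam - μ) = r}.Finite := by
      refine ((hw.finite_weights.image fun μ => ht (lam - μ)).preimage
        (f := fun r : ℕ => (r : ℂ)) Nat.cast_injective.injOn).subset ?_
      rintro r ⟨μ, hμ, hr⟩
      exact ⟨μ, hμ, hr⟩
    obtain ⟨R, hR⟩ := hfin.bddAbove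
    refine ⟨R + 1, fun r hr => ?_⟩
    rw [eq_bot_iff]
    refine (hEwt r).trans (iSup₂_le fun μ hμ => ?_)
    by_contra hne
    have : r ≤ R := hR ⟨μ, fun h => hne h.le, hμ⟩
    omega
  have htop : ⨆ r, E r = ⊤ := by
    refine eq_top_of_neg_stable X ρ hw.gen (Submodule.span ℂ {w})
      (Submodule.mem_span_singleton_self w) (fun i m v hv => ?_) (fun h m v hv => ?_) _
      (le_iSup E 0) fun i m v hv => ?_
    · obtain ⟨c, rfl⟩ := Submodule.mem_span_singleton.1 hv
      rw [map_smul, hw.pos, smul_zero]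
    · obtain ⟨c, rfl⟩ := Submodule.mem_span_singleton.1 hv
      rw [map_smul]
      exact Submodule.smul_mem _ c (hH h m)
    · induction hv using Submodule.iSup_induction' with
      | mem r v hv =>
        refine Submodule.mem_iSup_of_mem (r + 1) ?_
        rw [hEs]
        exact Submodule.apply_mem_map₂ LinearMap.id
          (Submodule.mem_iSup_of_mem i (Submodule.subset_span ⟨m, rfl⟩)) hv
      | zero => rw [map_zero]; exact Submodule.zero_mem _
      | add u v _ _ hu hv => rw [map_add]; exact Submodule.add_mem _ hu hv
  have hle : (⊤ : Submodule ℂ V) ≤ ⨆ r : Fin R, E r := by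
    rw [← htop]
    refine iSup_le fun r => ?_
    rcases lt_or_ge r R with hr | hr
    · exact le_iSup (fun r : Fin R => E r) ⟨r, hr⟩
    · rw [hR r hr]; exact bot_le
  refine Module.finite_def.2 ?_
  rw [eq_top_iff.2 hle |>.symm]
  exact Submodule.fg_iSup _ fun r => hEfin r

end FiniteDimension

/-! ### Recovering a series from its exponential; leading coefficients -/

section ExpSeries

variable {A : Type*} [Ring A] [Algebra ℂ A]

theorem constantCoeff_expSeries (F : PowerSeries A) :
    PowerSeries.constantCoeff (expSeries F) = 1 := by
  rw [← PowerSeries.coeff_zero_eq_constantCoeff_apply, expSeries, PowerSeries.coeff_mk]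
  simp

/-- The coefficients of `F` are polynomials in those of `exp F`. -/
theorem coeff_mem_of_expSeries_coeff_mem (S : Subalgebra ℂ A) (F : PowerSeries A)
    (hF0 : PowerSeries.coeff 0 F = 0) (h : ∀ m, PowerSeries.coeff m (expSeries F) ∈ S) (m : ℕ) :
    PowerSeries.coeff m F ∈ S := by
  induction m using Nat.strong_induction_on with
  | _ m ih =>
    rcases Nat.eq_zero_or_pos m with rfl | hm
    · rw [hF0]; exact S.zero_mem
    have hlow : ∀ n, ∀ l < m, PowerSeries.coeff l (F ^ n) ∈ S := by
      intro n
      induction n with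
      | zero =>
        intro l _
        rw [pow_zero, PowerSeries.coeff_one]
        split_ifs
        exacts [S.one_mem, S.zero_mem]
      | succ n ihn =>
        intro l hl
        rw [pow_succ, PowerSeries.coeff_mul]
        refine S.sum_mem fun p hp => ?_
        have := Finset.HasAntidiagonal.mem_antidiagonal.1 hp
        exact S.mul_mem (ihn _ (by omega)) (ih _ (by omega))
    -- As F has zero constant term, this coefficient involves only coefficients of F below m. Hence
    -- the coefficient of exp F at m > 0 is that of F plus a known element of S.
    have htop : ∀ n, PowerSeries.coeff m (F ^ (n + 2)) ∈ S := by
      intro n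
      rw [pow_succ' F (n + 1), PowerSeries.coeff_mul]
      refine S.sum_mem fun p hp => ?_
      have hp' := Finset.HasAntidiagonal.mem_antidiagonal.1 hp
      by_cases h1 : p.1 = 0
      · rw [h1, hF0, zero_mul]; exact S.zero_mem
      by_cases h2 : p.2 = 0
      · have : PowerSeries.coeff 0 (F ^ (n + 1)) = 0 := by
          rw [PowerSeries.coeff_zero_eq_constantCoeff_apply] at hF0 ⊢
          rw [map_pow, hF0, zero_pow (Nat.succ_ne_zero n)]
        rw [h2, this, mul_zero]; exact S.zero_mem
      exact S.mul_mem (ih _ (by omega)) (hlow _ _ (by omega))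
    have hm' := h m
    obtain ⟨l, rfl⟩ : ∃ l, m = l + 1 := ⟨m - 1, by omega⟩
    rw [expSeries, PowerSeries.coeff_mk, Finset.sum_range_succ', Finset.sum_range_succ'] at hm'
    simp only [pow_zero, PowerSeries.coeff_one, Nat.succ_ne_zero, if_false, smul_zero, add_zero,
      zero_add, pow_one, Nat.factorial_one, Nat.cast_one, inv_one, one_smul] at hm'
    have hs : ∑ k ∈ Finset.range l, (((k + 1 + 1).factorial : ℂ)⁻¹) •
        PowerSeries.coeff (l + 1) (F ^ (k + 1 + 1)) ∈ S :=
      S.sum_mem fun k _ => S.smul_mem (htop k) _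
    have := S.sub_mem hm' hs
    rwa [add_sub_cancel_left] at this

end ExpSeries

section Series

variable {g : Type*} [LieRing g] [LieAlgebra ℂ g]

/-- X⁻(u) is divisible by u, so only the leading coefficient x_0^n and the constant term 1 of Λ⁺
contribute. -/
theorem coeff_xZeroSeries_pow_mul (x h : g) (n : ℕ) :
    PowerSeries.coeff n (xZeroSeries x ^ n * lambdaSeries h 1) = uElt x 0 ^ n := by
  have hX : xZeroSeries x = PowerSeries.X * PowerSeries.mk fun m : ℕ => uElt x (m : ℤ) := by
    ext m
    rcases m with _ | m
    · simp [xZeroSeries]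
    · rw [PowerSeries.coeff_succ_X_mul, xZeroSeries, PowerSeries.coeff_mk, PowerSeries.coeff_mk,
        if_neg (Nat.succ_ne_zero m)]
      push_cast
      rw [add_sub_cancel_right]
  have hc : Commute (PowerSeries.X : PowerSeries (ULoop g))
      (PowerSeries.mk fun m : ℕ => uElt x (m : ℤ)) := (PowerSeries.commute_X _).symm
  rw [hX, hc.mul_pow, mul_assoc, PowerSeries.coeff_X_pow_mul', if_pos le_rfl, Nat.sub_self,
    PowerSeries.coeff_zero_eq_constantCoeff_apply, map_mul, map_pow, lambdaSeries,
    constantCoeff_expSeries, mul_one, ← PowerSeries.coeff_zero_eq_constantCoeff_apply,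
    PowerSeries.coeff_mk]
  rfl

theorem lambdaElt_natCast (h : g) (m : ℕ) :
    lambdaElt h m = PowerSeries.coeff m (lambdaSeries h 1) := by
  rw [lambdaElt, if_pos (Int.natCast_nonneg m), Int.natAbs_natCast]

/-- A subalgebra containing `h_0` and all coefficients of `Λ^±` contains all `h_m`. -/
theorem uElt_mem_of_lambdaSeries_mem (S : Subalgebra ℂ (ULoop g)) (h : g) (h0 : uElt h 0 ∈ S)
    (hp : ∀ s, PowerSeries.coeff s (lambdaSeries h 1) ∈ S)
    (hn : ∀ s, PowerSeries.coeff s (lambdaSeries h (-1)) ∈ S) (m : ℤ) : uElt h m ∈ S := by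
  have key : ∀ ε : ℤ, (∀ s, PowerSeries.coeff s (lambdaSeries h ε) ∈ S) →
      ∀ k : ℕ, k ≠ 0 → uElt h (ε * k) ∈ S := by
    intro ε hε k hk
    have h1 := coeff_mem_of_expSeries_coeff_mem S _
      (by rw [PowerSeries.coeff_mk, if_pos rfl]) hε k
    rw [PowerSeries.coeff_mk, if_neg hk] at h1
    have h2 := S.smul_mem (S.neg_mem h1) (k : ℂ)
    rwa [neg_neg, smul_smul, mul_inv_cancel₀ (Nat.cast_ne_zero.2 hk), one_smul] at h2
  rcases Int.eq_nat_or_neg m with ⟨k, rfl | rfl⟩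
  · rcases eq_or_ne k 0 with rfl | hk
    · exact h0
    · simpa using key 1 hp k hk
  · rcases eq_or_ne k 0 with rfl | hk
    · simpa using h0
    · simpa using key (-1) hn k hk

end Series

/-! ### Modules over the extended loop algebra -/

section Modules

variable {g : Type*} [LieRing g] [LieAlgebra ℂ g]

/-- The elements of an algebra which preserve a subspace. -/
def stabilizerSubalgebra {A V : Type*} [Ring A] [Algebra ℂ A] [AddCommGroup V] [Module ℂ V]
    (ρ : A →ₐ[ℂ] Module.End ℂ V) (N : Submodule ℂ V) : Subalgebra ℂ A where
  carrier := {a | ∀ v ∈ N, ρ a v ∈ N}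
  mul_mem' := fun ha hc v hv => by
    rw [map_mul, Module.End.mul_apply]; exact ha _ (hc v hv)
  add_mem' := fun ha hc v hv => by
    rw [map_add, LinearMap.add_apply]; exact N.add_mem (ha v hv) (hc v hv)
  algebraMap_mem' := fun r v hv => by
    rw [AlgHom.commutes, Module.algebraMap_end_apply]; exact N.smul_mem r hv

theorem uExtElt_mul (x y : g) (m n : ℤ) :
    uExtElt x m * uExtElt y n = uExtElt y n * uExtElt x m + uExtElt ⁅x, y⁆ (m + n) := by
  simp only [← uIncl_uElt, ← map_mul, ← map_add]
  rw [uElt_mul]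

theorem extD_mul_uExtElt (x : g) (m : ℤ) :
    UniversalEnvelopingAlgebra.ι ℂ (extD g) * uExtElt x m =
      uExtElt x m * UniversalEnvelopingAlgebra.ι ℂ (extD g) + (m : ℂ) • uExtElt x m := by
  have h : UniversalEnvelopingAlgebra.ι ℂ ⁅extD g, loopIncl g (loopElt x m)⁆ =
      UniversalEnvelopingAlgebra.ι ℂ (extD g) * uExtElt x m -
        uExtElt x m * UniversalEnvelopingAlgebra.ι ℂ (extD g) :=
    LieHom.map_lie (UniversalEnvelopingAlgebra.ι ℂ) _ _
  rw [lie_extD, map_smul] at h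
  rw [uExtElt, ← sub_eq_iff_eq_add']
  exact h.symm

theorem uExtElt_smul (c : ℂ) (x : g) (m : ℤ) : uExtElt (c • x) m = c • uExtElt x m := by
  rw [← uIncl_uElt, uElt_smul, map_smul, uIncl_uElt]

/-- If `w` is an eigenvector of `d`, then a subspace containing `w` and stable under `L(g)`
contains `U(Lᵉ(g)) w`. -/
theorem eq_top_of_uExtElt_stable {V : Type*} [AddCommGroup V] [Module ℂ V] [Module (UExt g) V]
    [IsScalarTower ℂ (UExt g) V] {w : V} (hspan : ∀ v : V, ∃ u : UExt g, v = u • w) {c : ℂ}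
    (hd : UniversalEnvelopingAlgebra.ι ℂ (extD g) • w = c • w)
    (N : Submodule ℂ V) (hw : w ∈ N) (hN : ∀ (x : g) m, ∀ v ∈ N, uExtElt x m • v ∈ N) :
    N = ⊤ := by
  let M := sInf {N : Submodule ℂ V | w ∈ N ∧ ∀ (x : g) m, ∀ v ∈ N, uExtElt x m • v ∈ N}
  have hMw : w ∈ M := by
    rw [Submodule.mem_sInf]; exact fun N hN => hN.1
  have hMs : ∀ (x : g) m, ∀ v ∈ M, uExtElt x m • v ∈ M := by
    intro x m v hv
    rw [Submodule.mem_sInf] at hv ⊢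
    exact fun N hN => hN.2 x m v (hv N hN)
  let D : Module.End ℂ V := Algebra.lsmul ℂ ℂ V (UniversalEnvelopingAlgebra.ι ℂ (extD g))
  -- Since [d, x_m] = m x_m, the vectors of M sent into M by d again form a subspace containing w
  -- and stable under L(g); minimality of M makes it d-stable.
  have hMD : M ≤ M ⊓ M.comap D := by
    refine sInf_le ⟨⟨hMw, ?_⟩, ?_⟩
    · change UniversalEnvelopingAlgebra.ι ℂ (extD g) • w ∈ M
      rw [hd]
      exact M.smul_mem c hMw
    · rintro x m v ⟨hv, hv'⟩
      refine ⟨hMs x m v hv, ?_⟩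
      change UniversalEnvelopingAlgebra.ι ℂ (extD g) • uExtElt x m • v ∈ M
      rw [← mul_smul, extD_mul_uExtElt, add_smul, mul_smul, smul_assoc]
      exact M.add_mem (hMs x m _ hv') (M.smul_mem _ (hMs x m v hv))
  have htop : stabilizerSubalgebra (Algebra.lsmul ℂ ℂ V) M = (⊤ : Subalgebra ℂ (UExt g)) :=
    subalgebra_eq_top_of_uExtElt_mem _ (fun x m v hv => hMs x m v hv) fun v hv => (hMD hv).2
  rw [eq_top_iff]
  intro v _
  obtain ⟨u, rfl⟩ := hspan v
  have hu : u ∈ stabilizerSubalgebra (Algebra.lsmul ℂ ℂ V) M := htop ▸ Algebra.mem_top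
  have hMN : M ≤ N := sInf_le ⟨hw, hN⟩
  exact hMN (hu w hMw)

end Modules

/-! ### Weights for 𝔥 ⊕ ℂd -/

section Extended

variable {g : Type*} [LieRing g] [LieAlgebra ℂ g] [FiniteDimensional ℂ g] [IsKilling ℂ g]
variable {H : LieSubalgebra ℂ g} [H.IsCartanSubalgebra]
variable {V : Type*} [AddCommGroup V] [Module ℂ V] [Module (UExt g) V] [IsScalarTower ℂ (UExt g) V]

omit [FiniteDimensional ℂ g] [IsKilling ℂ g] [H.IsCartanSubalgebra] in
theorem ι_cartanIncl (h : H) (c : ℂ) :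
    UniversalEnvelopingAlgebra.ι ℂ (cartanIncl H (h, c)) =
      uExtElt (h : g) 0 + c • UniversalEnvelopingAlgebra.ι ℂ (extD g) := by
  rw [← map_smul]
  exact map_add (UniversalEnvelopingAlgebra.ι ℂ) _ _

omit [FiniteDimensional ℂ g] [IsKilling ℂ g] [H.IsCartanSubalgebra] in
theorem uExtElt_smul_mem_weightSpace {x : g} {α : Dual ℂ H} {μ : Dual ℂ (H × ℂ)}
    (hx : ∀ h : H, ⁅(h : g), x⁆ = α h • x) (m : ℤ) {v : V} (hv : v ∈ weightSpace V H μ) :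
    uExtElt x m • v ∈
      weightSpace V H (μ + α.coprod (LinearMap.toSpanSingleton ℂ ℂ (m : ℂ))) := by
  rintro ⟨h, c⟩
  have hv' := hv (h, c)
  rw [ι_cartanIncl, add_smul, smul_assoc] at hv' ⊢
  rw [← mul_smul, ← mul_smul, uExtElt_mul, extD_mul_uExtElt, hx, zero_add, uExtElt_smul, add_smul,
    add_smul, smul_add, mul_smul, mul_smul, smul_assoc, smul_assoc]
  have : uExtElt x m • (uExtElt (h : g) 0 • v + c • UniversalEnvelopingAlgebra.ι ℂ (extD g) • v) =
      uExtElt x m • μ (h, c) • v := by rw [hv']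
  rw [smul_add, smul_algebra_smul_comm, smul_algebra_smul_comm] at this
  rw [LinearMap.add_apply, add_smul, ← this, LinearMap.coprod_apply,
    LinearMap.toSpanSingleton_apply, smul_eq_mul, add_smul, mul_smul]
  abel

variable (V H) in
theorem iSupIndep_weightSpace : iSupIndep (weightSpace V H) := by
  have hcomm : ∀ p q : H × ℂ, Commute (UniversalEnvelopingAlgebra.ι ℂ (cartanIncl H p))
      (UniversalEnvelopingAlgebra.ι ℂ (cartanIncl H q)) := by
    rintro ⟨h, c⟩ ⟨h', c'⟩
    rw [ι_cartanIncl, ι_cartanIncl]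
    have h1 : Commute (uExtElt (h : g) 0) (uExtElt (h' : g) 0) := by
      have := uElt_comm h h' 0 0
      rw [commute_iff_eq, ← uIncl_uElt, ← uIncl_uElt, ← map_mul, ← map_mul, this]
    have h2 : ∀ h : H, Commute (UniversalEnvelopingAlgebra.ι ℂ (extD g)) (uExtElt (h : g) 0) := by
      intro h
      rw [commute_iff_eq, extD_mul_uExtElt]
      simp
    exact ((h1.add_right ((h2 h).symm.smul_right c')).add_left
      (((h2 h').smul_left c).add_right (((Commute.refl _).smul_left c).smul_right c')))
  have := iSupIndep_iInf_eigenspace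
    (fun p : H × ℂ => Algebra.lsmul ℂ ℂ V (UniversalEnvelopingAlgebra.ι ℂ (cartanIncl H p)))
    (fun p q => (hcomm p q).map (Algebra.lsmul ℂ ℂ V)) (fun μ : Dual ℂ (H × ℂ) => ⇑μ)
    DFunLike.coe_injective
  convert! this using 2 with μ
  ext v
  simp only [Submodule.mem_iInf, Module.End.mem_eigenspace_iff]
  rfl

end Extended

/-! ### Integrability of W(λ) -/

section GlobalWeylModule

variable {g : Type*} [LieRing g] [LieAlgebra ℂ g] [FiniteDimensional ℂ g] [IsKilling ℂ g]
variable {H : LieSubalgebra ℂ g} [H.IsCartanSubalgebra] {b : (rootSystem H).Base}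

theorem neg_pow_mem_loopIdeal (X : RootVectors b) (lam : Dual ℂ (H × ℂ)) (i : b.support) (k : ℕ)
    (hk : lam ((rootSystem H).coroot i, 0) = k) :
    uElt (X.neg i) 0 ^ (k + 1) ∈ loopIdeal X lam := by
  -- Taking r = m = k + 1, the least admissible m, reduces the relation to the classical
  -- (x⁻_{i,0})^(k+1).
  have h := LoopGen.xZero (X := X) i k hk (k + 1) (by omega) (k + 1) (by omega) 1
    (uZero H).one_mem
  rw [coeff_xZeroSeries_pow_mul, mul_one] at h
  exact Submodule.subset_span h

variable (X : RootVectors b) (lam : Dual ℂ (H × ℂ))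

/-- The cyclic vector of `W(λ)`. -/
def globalGenerator : W X lam := (extIdeal X lam).mkQ 1

/-- The action of `U(L(g))` on `W(λ)`. -/
def globalAction : ULoop g →ₐ[ℂ] Module.End ℂ (W X lam) :=
  (Algebra.lsmul ℂ ℂ (W X lam)).comp (uIncl g)

theorem globalAction_apply (u : ULoop g) (v : W X lam) :
    globalAction X lam u v = uIncl g u • v := rfl

theorem globalAction_pow_uElt (x : g) (m : ℤ) (k : ℕ) (v : W X lam) :
    (globalAction X lam (uElt x m) ^ k) v = uExtElt x m ^ k • v := by
  rw [← map_pow, globalAction_apply, map_pow, uIncl_uElt]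

theorem smul_globalGenerator (u : UExt g) :
    u • globalGenerator X lam = (extIdeal X lam).mkQ u := by
  rw [globalGenerator, ← map_smul, smul_eq_mul, mul_one]

theorem globalAction_generator_of_mem {u : ULoop g} (hu : u ∈ loopIdeal X lam) :
    globalAction X lam u (globalGenerator X lam) = 0 := by
  rw [globalAction_apply, smul_globalGenerator, Submodule.mkQ_apply, Submodule.Quotient.mk_eq_zero]
  exact Submodule.subset_span (Or.inl ⟨u, hu, rfl⟩)

theorem extD_smul_globalGenerator :
    UniversalEnvelopingAlgebra.ι ℂ (extD g) • globalGenerator X lam =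
      lam (0, 1) • globalGenerator X lam := by
  rw [← algebraMap_smul (UExt g) (lam (0, 1)) (globalGenerator X lam), ← sub_eq_zero, ← sub_smul,
    smul_globalGenerator, Submodule.mkQ_apply, Submodule.Quotient.mk_eq_zero]
  exact Submodule.subset_span (Or.inr rfl)

theorem isIntegrableHighestWeight_globalGenerator
    (hlam : ∀ i : b.support, ∃ k : ℕ, lam ((rootSystem H).coroot i, 0) = k) :
    IsIntegrableHighestWeight (globalAction X lam) X (lam ∘ₗ LinearMap.inl ℂ H ℂ)
      (globalGenerator X lam) where
  gen N hw hN := by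
    refine eq_top_of_uExtElt_stable (fun v => ?_) (extD_smul_globalGenerator X lam) N hw
      fun x m v hv => ?_
    · obtain ⟨u, rfl⟩ := (extIdeal X lam).mkQ_surjective v
      exact ⟨u, (smul_globalGenerator X lam u).symm⟩
    · rw [← uIncl_uElt]
      exact hN x m v hv
  pos i m := globalAction_generator_of_mem X lam (Submodule.subset_span (.pos i m))
  cartan h := by
    have := globalAction_generator_of_mem X lam (Submodule.subset_span (LoopGen.cartan h))
    rw [map_sub, AlgHom.commutes, LinearMap.sub_apply, sub_eq_zero,
      Module.algebraMap_end_apply] at this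
    exact this
  neg i := by
    obtain ⟨k, hk⟩ := hlam i
    refine ⟨k + 1, ?_⟩
    rw [← map_pow]
    exact globalAction_generator_of_mem X lam (neg_pow_mem_loopIdeal X lam i k hk)
  int i := by
    obtain ⟨k, hk⟩ := hlam i
    exact ⟨k, by simpa using hk⟩

/-- The generator is a weight vector for 𝔥 ⊕ ℂd, and x_i^± ⊗ t^m and h ⊗ t^m carry weight vectors to
weight vectors. -/
theorem iSup_weightSpace_eq_top
    (hlam : ∀ i : b.support, ∃ k : ℕ, lam ((rootSystem H).coroot i, 0) = k) :
    ⨆ μ, weightSpace (W X lam) H μ = ⊤ := by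
  have hw := isIntegrableHighestWeight_globalGenerator X lam hlam
  have shift : ∀ (x : g) (α : Dual ℂ H), (∀ h : H, ⁅(h : g), x⁆ = α h • x) → ∀ m,
      ∀ v ∈ ⨆ μ, weightSpace (W X lam) H μ,
        globalAction X lam (uElt x m) v ∈ ⨆ μ, weightSpace (W X lam) H μ := by
    intro x α hx m v hv
    induction hv using Submodule.iSup_induction' with
    | mem μ v hv =>
      rw [globalAction_apply, uIncl_uElt]
      exact Submodule.mem_iSup_of_mem _ (uExtElt_smul_mem_weightSpace hx m hv)
    | zero => rw [map_zero]; exact Submodule.zero_mem _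
    | add u v _ _ hu hv => rw [map_add]; exact Submodule.add_mem _ hu hv
  refine eq_top_of_simple_stable X (globalAction X lam) hw.gen _
    (Submodule.mem_iSup_of_mem lam ?_) (fun h m => shift h 0 (fun h' => ?_) m)
    (fun i m => shift _ _ (lie_simple_pos X i) m) (fun i m => shift _ _ (lie_simple_neg X i) m)
  · rintro ⟨h, c⟩
    have h1 := hw.cartan h
    rw [globalAction_apply, uIncl_uElt] at h1
    have h2 : lam (h, c) = lam (h, 0) + c * lam (0, 1) := by
      rw [← smul_eq_mul, ← map_smul, ← map_add]
      simp
    rw [ι_cartanIncl, add_smul, smul_assoc, h1, extD_smul_globalGenerator, h2, add_smul, mul_smul]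
    rfl
  · rw [LinearMap.zero_apply, zero_smul, ← LieSubalgebra.coe_bracket, trivial_lie_zero H H h' h,
      ZeroMemClass.coe_zero]

theorem isIntegrable_globalWeylModule {θ : H.root} (hθ : b.IsPos θ)
    (hlam : ∀ i : b.support, ∃ k : ℕ, lam ((rootSystem H).coroot i, 0) = k) :
    IsIntegrable (W X lam) X θ := by
  classical
  have hw := isIntegrableHighestWeight_globalGenerator X lam hlam
  have hpos : ∀ α : H.root, b.IsPos α → ∀ m, IsLocallyNilpotent (W X lam) (uExtElt (X.pos α) m) := by
    intro α hα m v
    obtain ⟨k, hk⟩ := hw.exists_pow_pos_eq_zero hα m v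
    exact ⟨k, by rw [← hk, globalAction_pow_uElt]⟩
  have hneg : ∀ α : H.root, b.IsPos α → ∀ m, IsLocallyNilpotent (W X lam) (uExtElt (X.neg α) m) := by
    intro α hα m v
    obtain ⟨k, hk⟩ := hw.exists_pow_neg_eq_zero hα m v
    exact ⟨k, by rw [← hk, globalAction_pow_uElt]⟩
  exact
    { pos := fun i => hpos i (b.isPos_of_mem_support i.2) 0
      neg := fun i => hneg i (b.isPos_of_mem_support i.2) 0
      zero_pos := hneg θ hθ 1
      zero_neg := hpos θ hθ (-1)
      isInternal := (DirectSum.isInternal_submodule_iff_iSupIndep_and_iSup_eq_top _).2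
        ⟨iSupIndep_weightSpace H _, iSup_weightSpace_eq_top X lam hlam⟩ }

end GlobalWeylModule

/-! ### Finite-dimensionality of W(π) -/

section LocalWeylModule

variable {g : Type*} [LieRing g] [LieAlgebra ℂ g] [FiniteDimensional ℂ g] [IsKilling ℂ g]
variable {H : LieSubalgebra ℂ g} [H.IsCartanSubalgebra] {b : (rootSystem H).Base}
variable (X : RootVectors b) (π : b.support → Polynomial ℂ) (a : ℂ)

/-- The image in `W(π)` of `u ⊗ c`. -/
def localMk (u : ULoop g) (c : uZero H) : WPi X π a :=
  (balancing X π a).mkQ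
    ((loopIdeal X (weightOf π a)).mkQ u ⊗ₜ[ℂ] (zeroIdeal π).mkQ c)

/-- The cyclic vector of `W(π)`. -/
def localGenerator : WPi X π a := localMk X π a 1 1

/-- The action of `U(L(g))` on `W(π)`. -/
def localAction : ULoop g →ₐ[ℂ] Module.End ℂ (WPi X π a) := Algebra.lsmul ℂ ℂ (WPi X π a)

theorem localAction_localMk (u u' : ULoop g) (c : uZero H) :
    localAction X π a u (localMk X π a u' c) = localMk X π a (u * u') c := rfl

theorem localMk_mul (u : ULoop g) (x c : uZero H) :
    localMk X π a (u * x) c = localMk X π a u (x * c) := by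
  refine (Submodule.Quotient.eq _).2 (Submodule.subset_span ?_)
  exact ⟨(loopIdeal X (weightOf π a)).mkQ u, x, (zeroIdeal π).mkQ c, rfl⟩

theorem localMk_of_mem {u : ULoop g} (hu : u ∈ loopIdeal X (weightOf π a)) (c : uZero H) :
    localMk X π a u c = 0 := by
  have : (loopIdeal X (weightOf π a)).mkQ u = 0 := by
    rwa [Submodule.mkQ_apply, Submodule.Quotient.mk_eq_zero]
  rw [localMk, this, TensorProduct.zero_tmul, map_zero]

theorem localAction_generator (u : ULoop g) :
    localAction X π a u (localGenerator X π a) = localMk X π a u 1 := by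
  rw [localGenerator, localAction_localMk, mul_one]

theorem localAction_generator_of_mem {u : ULoop g} (hu : u ∈ loopIdeal X (weightOf π a)) :
    localAction X π a u (localGenerator X π a) = 0 := by
  rw [localAction_generator, localMk_of_mem X π a hu]

/-- Moving x across the tensor product turns x ⊗ 1 into 1 ⊗ x, and x acts on ℂ_π as the scalar c. -/
theorem localAction_generator_of_zeroGen (x : uZero H) (c : ℂ)
    (hx : x - algebraMap ℂ _ c ∈ zeroIdeal π) :
    localAction X π a (x : ULoop g) (localGenerator X π a) = c • localGenerator X π a := by
  have h0 : localMk X π a 1 (x - algebraMap ℂ _ c) = 0 := by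
    have : (zeroIdeal π).mkQ (x - algebraMap ℂ _ c) = 0 := by
      rwa [Submodule.mkQ_apply, Submodule.Quotient.mk_eq_zero]
    rw [localMk, this, TensorProduct.tmul_zero, map_zero]
  have h1 := localMk_mul X π a 1 (x - algebraMap ℂ _ c) 1
  rw [mul_one, h0, one_mul, ← localAction_generator, Subalgebra.coe_sub, map_sub,
    LinearMap.sub_apply, sub_eq_zero, Subalgebra.coe_algebraMap, AlgHom.commutes,
    Module.algebraMap_end_apply] at h1
  exact h1

theorem localAction_generator_lambdaSeries (i : b.support) (s : ℕ) :
    localAction X π a (PowerSeries.coeff s (lambdaSeries (simpleCoroot b i) 1))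
      (localGenerator X π a) = (π i).coeff s • localGenerator X π a :=
  localAction_generator_of_zeroGen X π a ⟨_, lambdaSeries_coeff_mem i 1 (by decide) s⟩ _
    (Submodule.subset_span (.plus i s))

theorem localAction_generator_lambdaSeries_neg (i : b.support) (s : ℕ) :
    localAction X π a (PowerSeries.coeff s (lambdaSeries (simpleCoroot b i) (-1)))
      (localGenerator X π a) = (minusPoly (π i)).coeff s • localGenerator X π a :=
  localAction_generator_of_zeroGen X π a ⟨_, lambdaSeries_coeff_mem i (-1) (by decide) s⟩ _
    (Submodule.subset_span (.minus i s))

theorem isIntegrableHighestWeight_localGenerator :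
    IsIntegrableHighestWeight (localAction X π a) X (weightOf π a ∘ₗ LinearMap.inl ℂ H ℂ)
      (localGenerator X π a) where
  gen N hw hN := by
    have htop : stabilizerSubalgebra (localAction X π a) N = ⊤ :=
      subalgebra_eq_top_of_uElt_mem _ hN
    rw [eq_top_iff]
    intro v _
    obtain ⟨z, rfl⟩ := (balancing X π a).mkQ_surjective v
    induction z using TensorProduct.induction_on with
    | zero => rw [map_zero]; exact N.zero_mem
    | add x y hx hy => rw [map_add]; exact N.add_mem (hx trivial) (hy trivial)
    | tmul u c =>
      obtain ⟨u, rfl⟩ := (loopIdeal X (weightOf π a)).mkQ_surjective u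
      obtain ⟨c, rfl⟩ := (zeroIdeal π).mkQ_surjective c
      change localMk X π a u c ∈ N
      -- Every u ⊗ c equals uc ⊗ 1, so 1 ⊗ 1 generates W(π).
      have h := localMk_mul X π a u c 1
      rw [mul_one, ← localAction_generator] at h
      rw [← h]
      have hu : u * (c : ULoop g) ∈ stabilizerSubalgebra (localAction X π a) N :=
        htop ▸ Algebra.mem_top
      exact hu _ hw
  pos i m := localAction_generator_of_mem X π a (Submodule.subset_span (.pos i m))
  cartan h := by
    have := localAction_generator_of_mem X π a (Submodule.subset_span (LoopGen.cartan h))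
    rw [map_sub, AlgHom.commutes, LinearMap.sub_apply, sub_eq_zero,
      Module.algebraMap_end_apply] at this
    exact this
  neg i := by
    refine ⟨(π i).natDegree + 1, ?_⟩
    rw [← map_pow]
    exact localAction_generator_of_mem X π a
      (neg_pow_mem_loopIdeal X _ i _ (weightOf_coroot π a i))
  int i := ⟨(π i).natDegree, by simpa using! weightOf_coroot π a i⟩

/-- The elements preserving the line through the generator form a subalgebra. It contains h_{i,0}
and the coefficients of Λ_i^±, hence every h_{i,m}, and the h_i span H. -/
theorem localAction_cartan_mem_span (h : H) (m : ℤ) :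
    localAction X π a (uElt (h : g) m) (localGenerator X π a) ∈
      Submodule.span ℂ {localGenerator X π a} := by
  set N := Submodule.span ℂ {localGenerator X π a}
  have mem_of_eq : ∀ (u : ULoop g) (c : ℂ),
      localAction X π a u (localGenerator X π a) = c • localGenerator X π a →
      u ∈ stabilizerSubalgebra (localAction X π a) N := by
    intro u c hu v hv
    obtain ⟨e, rfl⟩ := Submodule.mem_span_singleton.1 hv
    rw [map_smul, hu]
    exact N.smul_mem _ (N.smul_mem _ (Submodule.mem_span_singleton_self _))
  have hi : ∀ i : b.support,
      uElt (simpleCoroot b i) m ∈ stabilizerSubalgebra (localAction X π a) N := fun i =>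
    uElt_mem_of_lambdaSeries_mem _ _
      (mem_of_eq _ _ ((isIntegrableHighestWeight_localGenerator X π a).cartan _))
      (fun s => mem_of_eq _ _ (localAction_generator_lambdaSeries X π a i s))
      (fun s => mem_of_eq _ _ (localAction_generator_lambdaSeries_neg X π a i s)) m
  have hmem : uElt (h : g) m ∈ stabilizerSubalgebra (localAction X π a) N := by
    have hh : h ∈ Submodule.span ℂ (Set.range b.toCoweightBasis) := by
      rw [b.toCoweightBasis.span_eq]; trivial
    induction hh using Submodule.span_induction with
    | mem x hx =>
      obtain ⟨i, rfl⟩ := hx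
      rw [b.toCoweightBasis_apply]
      exact hi i
    | zero => rw [ZeroMemClass.coe_zero, uElt_zero]; exact Subalgebra.zero_mem _
    | add x y _ _ hx hy =>
      rw [AddMemClass.coe_add, uElt_add]; exact Subalgebra.add_mem _ hx hy
    | smul c x _ hx =>
      rw [SetLike.val_smul, uElt_smul]; exact Subalgebra.smul_mem _ hx c
  exact hmem _ (Submodule.mem_span_singleton_self _)

theorem sum_smul_localAction_neg_eq_zero (i : b.support) (m : ℤ) :
    ∑ j ∈ Finset.range ((π i).natDegree + 1), (π i).coeff j •
      localAction X π a (uElt (X.neg i) (m - j)) (localGenerator X π a) = 0 :=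
  sum_smul_eq_zero_of_sum_mul (X.neg i) _ _ _
    (fun j => by rw [lambdaElt_natCast]; exact localAction_generator_lambdaSeries X π a i j) _ m
    (localAction_generator_of_mem X π a (Submodule.subset_span
      -- The index m + 1 offsets the shift by −1 in this relation.
      (LoopGen.xTilde (X := X) i _ (weightOf_coroot π a i) (m + 1) 1 (uZero H).one_mem)))

theorem finiteDimensional_localWeylModule (hπ : ∀ i, (π i).coeff 0 = 1) :
    FiniteDimensional ℂ (WPi X π a) :=
  (isIntegrableHighestWeight_localGenerator X π a).finiteDimensional
    (localAction_cartan_mem_span X π a) fun i =>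
      exists_laurentAction_eq_zero_of_sum (X.neg i) (localGenerator X π a) _ _ (hπ i)
        (sum_smul_localAction_neg_eq_zero X π a i)

end LocalWeylModule

end WeylModule

end

theorem theorem1 {g : Type*} [LieRing g] [LieAlgebra ℂ g] [FiniteDimensional ℂ g]
    [LieAlgebra.IsSimple ℂ g] (H : LieSubalgebra ℂ g) [H.IsCartanSubalgebra]
    (b : (LieAlgebra.IsKilling.rootSystem H).Base) (X : RootVectors b)
    (θ : H.root) (hθ : IsHighestRoot b θ) :
    (∀ lam : Module.Dual ℂ (H × ℂ), IsDominantIntegral b lam →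
      IsIntegrable (W X lam) X θ) ∧
    (∀ π : b.support → Polynomial ℂ, (∀ i, (π i).coeff 0 = 1) → ∀ a : ℂ,
      FiniteDimensional ℂ (WPi X π a)) :=
  ⟨fun lam hlam => isIntegrable_globalWeylModule X lam hθ.isPos hlam.1,
    fun π hπ a => finiteDimensional_localWeylModule X π a hπ⟩
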